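/- Fix a local dimension $d$. Let $\rho=(\rho_N)_{N\ge 1}$ be a family of operators on rings of $N$ sites, each site with Hilbert space $\mathbb C^d$. For $p\ge 1$ and matrices $\mathbb A^{ij}\in M_\chi(\mathbb C)$, where $i,j\in\{1,\dots,d\}^p$ run over the basis states of $p$ neighbouring sites, say that $\rho$ is generated by $\mathbb A$ with unit cell $p$ if, after grouping the sites into blocks of $p$ consecutive sites, $$\rho_{np}=\sum_{i_1,j_1,\dots,i_n,j_n}\operatorname{tr}\big(\mathbb A^{i_1j_1}\cdots\mathbb A^{i_nj_n}\big)\,|i_1\cdots i_n\rangle\langle j_1\cdots j_n|\qquad\text{for all } n\ge 1 .$$ * $\rho$ is an MPDO (matrix product density operator, not necessarily normalised) if for some $p\ge1$ it is generated with unit cell $p$ by some tensor $\mathbb A$ of some finite bond dimension $\chi$, and $\rho_{np}\ge 0$ for all $n\ge1$. * A tensor $\mathbb A$ is strong injective if (1) the linear map $\mathbb C^\chi\otimes\mathbb C^\chi\to\mathbb C^{d^p}\otimes\mathbb C^{d^p}$, $X\mapsto\big(\sum_{\alpha\beta}\mathbb A^{ij}_{\alpha\beta}X_{\alpha\beta}\big)_{ij}$,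 is injective, and (2) the transfer matrix $\mathbb T=\sum_i\mathbb A^{ii}$ has a unique largest eigenvalue: a real eigenvalue $\lambda>0$ of algebraic multiplicity one such that every other complex eigenvalue $\mu$ satisfies $|\mu|<\lambda$. * $\rho$ is strong injective if, after grouping some finite number $p\ge1$ of neighbouring sites, it is generated by a strong injective tensor. A quantum channel $X\mapsto\sum_aK_aXK_a^\dagger$, $\sum_aK_a^\dagger K_a=\mathbb 1$, is non-degenerate if it is injective on the space of all operators. A brickwork circuit of depth $t$ on a ring of an even number $N$ of sites is a composition of $t$ layers, numbered $0,\dots,t-1$; an even layer is a product of two-site channels on the pairs $(2k,2k+1)$ and an odd layer is one on the pairs $(2k+1,2k+2)$, with sites taken modulo $N$. The individual channels may differ from gate to gate and with $N$. **Proposition.** Let $t\ge0$, let $\rho$ and $\rho'$ be MPDOs, and suppose that for every even $N\ge2$ we have $\rho'_N=\mathcal N_N[\rho_N]$, where $\mathcal N_N$ is a brickwork circuit of depth $t$ all of whose two-site channels are non-degenerate. Then $\rho'$ is strong injective if and only if $\rho$ is strong injective. -/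

import Mathlib

noncomputable section

namespace StrongInjectiveMPDO

open Matrix
open scoped ComplexOrder

/-- Operators on a ring of `N` sites; `σ` indexes the standard basis of the one-site space. -/
abbrev ChainOp (σ : Type) (N : ℕ) : Type := Matrix (Fin N → σ) (Fin N → σ) ℂ

/-- A family of operators, one for every system size (local dimension `d`). -/
abbrev ChainFamily (d : ℕ) : Type := (N : ℕ) → ChainOp (Fin d) N

/-- A translationally invariant matrix product operator tensor: physical ket index, physical bra
index, and a `χ × χ` matrix on the virtual space. -/
abbrev LocalTensor (σ : Type) (χ : ℕ) : Type := σ → σ → Matrix (Fin χ) (Fin χ) ℂ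

/-- The operator `∑ tr (A^{i₁ j₁} ⋯ A^{i_N j_N}) |i₁ … i_N⟩⟨j₁ … j_N|`. -/
def mpdo {σ : Type} {χ : ℕ} (A : LocalTensor σ χ) (N : ℕ) : ChainOp σ N :=
  Matrix.of fun i j => ((List.ofFn fun x => A (i x) (j x)).prod).trace

/-- Grouping `p` neighbouring sites: the operator of the family on `n * p` sites, read as an
operator on `n` blocks of `p` consecutive sites (site `y` of block `x` is site `y + p * x`). -/
def grouped {d : ℕ} (p : ℕ) (ρ : ChainFamily d) (n : ℕ) : ChainOp (Fin p → Fin d) n :=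
  Matrix.of fun i j =>
    ρ (n * p) (fun s => i (finProdFinEquiv.symm s).1 (finProdFinEquiv.symm s).2)
      (fun s => j (finProdFinEquiv.symm s).1 (finProdFinEquiv.symm s).2)

/-- With unit cells of `p` sites, the family is generated by the tensor `A`. -/
def GeneratedBy {d χ : ℕ} (ρ : ChainFamily d) (p : ℕ) (A : LocalTensor (Fin p → Fin d) χ) : Prop :=
  ∀ n : ℕ, 1 ≤ n → grouped p ρ n = mpdo A n

/-- A matrix product density operator, not necessarily normalised: a positive semidefinite family
generated, for some finite unit cell, by one tensor independent of the system size. -/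
def IsMPDO {d : ℕ} (ρ : ChainFamily d) : Prop :=
  ∃ p : ℕ, 1 ≤ p ∧
    (∃ (χ : ℕ) (A : LocalTensor (Fin p → Fin d) χ), GeneratedBy ρ p A) ∧
    ∀ n : ℕ, 1 ≤ n → (ρ (n * p)).PosSemidef

/-- The tensor as a map from the virtual space `ℂ^χ ⊗ ℂ^χ` to the physical (ket and bra) space. -/
def virtualToPhysical {σ : Type} {χ : ℕ} (A : LocalTensor σ χ)
    (X : Matrix (Fin χ) (Fin χ) ℂ) : Matrix σ σ ℂ :=
  Matrix.of fun i j => ∑ α, ∑ β, A i j α β * X α β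

/-- The transfer matrix `∑ᵢ A^{ii}`. -/
def transferMatrix {σ : Type} [Fintype σ] {χ : ℕ} (A : LocalTensor σ χ) :
    Matrix (Fin χ) (Fin χ) ℂ :=
  ∑ i, A i i

/-- There is a positive real eigenvalue, of algebraic multiplicity one, and all other (complex)
eigenvalues are strictly smaller in modulus. -/
def HasUniqueLargestEigenvalue {χ : ℕ} (T : Matrix (Fin χ) (Fin χ) ℂ) : Prop :=
  ∃ r : ℝ, 0 < r ∧ T.charpoly.rootMultiplicity (r : ℂ) = 1 ∧
    ∀ z : ℂ, T.charpoly.IsRoot z → z ≠ (r : ℂ) → ‖z‖ < r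

/-- The two strong injectivity conditions on a tensor. -/
structure IsStrongInjectiveTensor {σ : Type} [Fintype σ] {χ : ℕ} (A : LocalTensor σ χ) : Prop where
  injective : Function.Injective (virtualToPhysical A)
  transfer : HasUniqueLargestEigenvalue (transferMatrix A)

/-- The family is strong injective: after grouping finitely many neighbouring sites it is
generated by a strong injective tensor. -/
def IsStrongInjective {d : ℕ} (ρ : ChainFamily d) : Prop :=
  ∃ p : ℕ, 1 ≤ p ∧ ∃ (χ : ℕ) (A : LocalTensor (Fin p → Fin d) χ),
    IsStrongInjectiveTensor A ∧ GeneratedBy ρ p A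

/-- Linear maps on the operators of a finite-dimensional space with basis `κ`. -/
abbrev SuperOp (κ : Type) : Type := Matrix κ κ ℂ →ₗ[ℂ] Matrix κ κ ℂ

/-- Quantum channels, in Kraus form. -/
def IsQuantumChannel {κ : Type} [Fintype κ] [DecidableEq κ] (Φ : SuperOp κ) : Prop :=
  ∃ (m : ℕ) (K : Fin m → Matrix κ κ ℂ), ∑ a, (K a)ᴴ * K a = 1 ∧
    ∀ X, Φ X = ∑ a, K a * X * (K a)ᴴ

/-- Non-degenerate channels: injective on the whole operator space. -/
structure IsNondegenerateChannel {κ : Type} [Fintype κ] [DecidableEq κ] (Φ : SuperOp κ) :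
    Prop where
  channel : IsQuantumChannel Φ
  injective : Function.Injective Φ

/-- The configuration `i` with the entries at sites `x` and `y` replaced by `a`. -/
def setPair {d N : ℕ} (i : Fin N → Fin d) (x y : Fin N) (a : Fin d × Fin d) : Fin N → Fin d :=
  Function.update (Function.update i x a.1) y a.2

/-- `Φ ⊗ id`, where the two-site map `Φ` acts on the (distinct) sites `x`, `y` and the identity
acts on all other sites. -/
def onSites {d N : ℕ} (Φ : SuperOp (Fin d × Fin d)) (x y : Fin N) : SuperOp (Fin N → Fin d) where
  toFun X := Matrix.of fun i j =>
    Φ (Matrix.of fun a b => X (setPair i x y a) (setPair j x y b)) (i x, i y) (j x, j y)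
  map_add' X Y := by
    ext i j
    have h : (Matrix.of fun a b => (X + Y) (setPair i x y a) (setPair j x y b)) =
        (Matrix.of fun a b => X (setPair i x y a) (setPair j x y b)) +
          Matrix.of fun a b => Y (setPair i x y a) (setPair j x y b) := rfl
    rw [Matrix.of_apply, h, map_add]
    rfl
  map_smul' c X := by
    ext i j
    have h : (Matrix.of fun a b => (c • X) (setPair i x y a) (setPair j x y b)) =
        c • Matrix.of fun a b => X (setPair i x y a) (setPair j x y b) := rfl
    rw [Matrix.of_apply, h, map_smul]
    rfl

/-- First site of the `k`-th gate of layer `s`: `2k` in even layers, `2k + 1` in odd layers. -/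
def gateLeft {N : ℕ} (s : ℕ) (k : Fin (N / 2)) : Fin N :=
  ⟨2 * k.1 + s % 2, by have := k.2; omega⟩

/-- Second site of the `k`-th gate of layer `s`: the right neighbour on the ring. -/
def gateRight {N : ℕ} (s : ℕ) (k : Fin (N / 2)) : Fin N :=
  ⟨(2 * k.1 + s % 2 + 1) % N, Nat.mod_lt _ (by have := k.2; omega)⟩

/-- One layer of a brickwork circuit on a ring of `N` sites (`N` even): a product of maps acting
on disjoint pairs of neighbours. -/
def layer {d N : ℕ} (s : ℕ) (G : Fin (N / 2) → SuperOp (Fin d × Fin d)) :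
    Module.End ℂ (ChainOp (Fin d) N) :=
  (List.ofFn fun k => (onSites (G k) (gateLeft s k) (gateRight s k) :
    Module.End ℂ (ChainOp (Fin d) N))).prod

/-- The brickwork circuit with layers `0, …, t - 1`, layer `0` acting first. -/
def brickwork {d N : ℕ} (G : ℕ → Fin (N / 2) → SuperOp (Fin d × Fin d)) :
    ℕ → Module.End ℂ (ChainOp (Fin d) N)
  | 0 => 1
  | t + 1 => layer t (G t) * brickwork G t

/-- Brickwork circuits of depth `t` all of whose gates are non-degenerate channels. The gates may
vary from layer to layer and from place to place. -/
def IsNondegenerateBrickwork {d N : ℕ} (t : ℕ) (E : Module.End ℂ (ChainOp (Fin d) N)) : Prop :=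
  ∃ G : ℕ → Fin (N / 2) → SuperOp (Fin d × Fin d),
    (∀ s, s < t → ∀ k, IsNondegenerateChannel (G s k)) ∧ E = brickwork G t

end StrongInjectiveMPDO

end

/-!
An invertible trace-preserving gate that does not cut two disjoint regions `b₁` and `b₂` preserves
every property of the correlations between them that is invariant under invertible operations
inside `b₁`, inside `b₂` and under trace-preserving ones outside both. Cutting the ring into four
quarters and giving up `t` sites at each end of two opposite ones, such properties pass through a
circuit of depth `t` in both directions. Two of them are used: independence (a product functional
kills the operator only if one of its factors does), which holds for every injective tensor, and the
operator Schmidt rank after tracing out the rest, which is the square of the rank of a power of the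
transfer matrix.

Let `A` be a strong injective tensor of `ρ` and `D` any tensor of `ρ'`. Equality of traces gives the
two transfer matrices the same nonzero eigenvalues. Up to traces of products, `D` is a direct sum
`B ⊕ C` with `B` irreducible and carrying the dominant eigenvalue, so `B` becomes injective after
blocking. If `b` and `c` count the nonzero eigenvalues of the transfer matrices of `B` and `C`, then
comparing Schmidt ranks gives `(b + c) ^ 2 ≤ b ^ 2 + c ^ 2`, and `1 ≤ b` forces `c = 0`. A nilpotent
transfer matrix of `C` allows functionals to see `B` but not `C`, and the other way round, and then
independence between two regions makes the contribution of `C` to `ρ'` vanish.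
-/

namespace StrongInjectiveMPDO

open Matrix Module

section Spectra

open Polynomial

variable {K : Type*} [Field K]

theorem trace_pow_restrict_maxGenEigenspace {V : Type*} [AddCommGroup V] [Module K V]
    [FiniteDimensional K V] (f : End K V) (μ : K) (k : ℕ) :
    LinearMap.trace K _ ((f.restrict
        (f.mapsTo_maxGenEigenspace_of_comm (Commute.refl f) μ)) ^ k) =
      finrank K (f.maxGenEigenspace μ) * μ ^ k := by
  set g := f.restrict (f.mapsTo_maxGenEigenspace_of_comm (Commute.refl f) μ)
  have nilpotent : IsNilpotent (g - algebraMap K _ μ) :=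
    f.isNilpotent_restrict_maxGenEigenspace_sub_algebraMap μ
  induction k with
  | zero => simp
  | succ k ih =>
    rw [pow_succ, End.mul_eq_comp, LinearMap.trace_comp_eq_mul_of_commute_of_isNilpotent μ
      (Commute.pow_self g k) nilpotent, ih]
    ring

theorem trace_pow_eq_sum_finrank_maxGenEigenspace [IsAlgClosed K] {V : Type*} [AddCommGroup V]
    [Module K V] [FiniteDimensional K V] (f : End K V)
    (finite : {μ | f.maxGenEigenspace μ ≠ ⊥}.Finite) (k : ℕ) :
    LinearMap.trace K V (f ^ k) =
      ∑ μ ∈ finite.toFinset, finrank K (f.maxGenEigenspace μ) * μ ^ k := by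
  classical
  have internal : DirectSum.IsInternal f.maxGenEigenspace :=
    DirectSum.isInternal_submodule_of_iSupIndep_of_iSup_eq_top
      f.independent_maxGenEigenspace f.iSup_maxGenEigenspace_eq_top
  have mapsTo (μ : K) := f.mapsTo_maxGenEigenspace_of_comm (Commute.refl f) μ
  have mapsTo_pow (μ : K) :=
    f.mapsTo_maxGenEigenspace_of_comm ((Commute.refl f).pow_right k) μ
  rw [LinearMap.trace_eq_sum_trace_restrict' internal finite mapsTo_pow]
  refine Finset.sum_congr rfl fun μ _ => ?_
  rw [← trace_pow_restrict_maxGenEigenspace, Module.End.pow_restrict k (mapsTo μ)]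

theorem trace_pow_eq_sum_roots_charpoly [IsAlgClosed K] {ι : Type*} [Fintype ι] [DecidableEq ι]
    (T : Matrix ι ι K) (k : ℕ) : (T ^ k).trace = (T.charpoly.roots.map (· ^ k)).sum := by
  classical
  have finite : {μ | End.maxGenEigenspace T.toLin' μ ≠ ⊥}.Finite :=
    WellFoundedGT.finite_ne_bot_of_iSupIndep (End.independent_maxGenEigenspace _)
  have multiplicity (μ : K) :
      finrank K (End.maxGenEigenspace T.toLin' μ) = T.charpoly.roots.count μ := by
    rw [LinearMap.finrank_maxGenEigenspace_eq, charpoly_toLin', count_roots]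
  have support : finite.toFinset = T.charpoly.roots.toFinset := by
    ext μ
    rw [Set.Finite.mem_toFinset, Set.mem_ofPred_eq, Multiset.mem_toFinset, ← Multiset.count_ne_zero,
      ← multiplicity, ne_eq, ne_eq, Submodule.finrank_eq_zero]
  rw [← trace_toLin'_eq, toLin'_pow, trace_pow_eq_sum_finrank_maxGenEigenspace _ finite, support,
    Finset.sum_multiset_map_count]
  simp only [multiplicity, nsmul_eq_mul]

theorem linearIndependent_pow : LinearIndependent K fun (z : K) (n : ℕ) => z ^ n :=
  (linearIndependent_monoidHom (Multiplicative ℕ) K).comp (powersHom K) (powersHom K).injective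

theorem eq_of_sum_mul_pow_succ_eq {F : Finset K} {c e : K → K}
    (h : ∀ n : ℕ, ∑ z ∈ F, c z * z ^ (n + 1) = ∑ z ∈ F, e z * z ^ (n + 1)) {a : K} (haF : a ∈ F)
    (ha : a ≠ 0) : c a = e a := by
  have relation : ∑ z ∈ F, ((c z - e z) * z) • (fun n : ℕ => z ^ n) = 0 := by
    funext n
    rw [Pi.zero_apply, ← sub_eq_zero.2 (h n), ← Finset.sum_sub_distrib, Finset.sum_apply]
    refine Finset.sum_congr rfl fun z _ => ?_
    rw [Pi.smul_apply, smul_eq_mul]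
    ring
  have := linearIndependent_iff'.1 (linearIndependent_pow (K := K)) F
    (fun z => (c z - e z) * z) relation a haF
  exact sub_eq_zero.1 ((mul_eq_zero.1 this).resolve_right ha)

variable [DecidableEq K]

theorem sum_map_pow_eq_sum_count {s : Multiset K} {F : Finset K} (hF : s.toFinset ⊆ F) (n : ℕ) :
    (s.map (· ^ n)).sum = ∑ z ∈ F, (s.count z : K) * z ^ n := by
  rw [Finset.sum_multiset_map_count]
  simp only [nsmul_eq_mul]
  refine Finset.sum_subset hF fun z _ hz => ?_
  rw [Multiset.mem_toFinset, ← Multiset.count_eq_zero] at hz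
  simp [hz]

theorem filter_ne_zero_eq_of_sum_map_pow_eq [CharZero K] {s t : Multiset K}
    (h : ∀ n : ℕ, 1 ≤ n → (s.map (· ^ n)).sum = (t.map (· ^ n)).sum) :
    s.filter (· ≠ 0) = t.filter (· ≠ 0) := by
  refine Multiset.ext.2 fun a => ?_
  rcases eq_or_ne a 0 with rfl | ha
  · simp
  have subset_s : s.toFinset ⊆ insert a (s.toFinset ∪ t.toFinset) :=
    Finset.subset_union_left.trans (Finset.subset_insert _ _)
  have subset_t : t.toFinset ⊆ insert a (s.toFinset ∪ t.toFinset) :=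
    Finset.subset_union_right.trans (Finset.subset_insert _ _)
  have count_eq : (s.count a : K) = t.count a :=
    eq_of_sum_mul_pow_succ_eq (c := fun z : K => s.count z) (e := fun z : K => t.count z)
      (fun n => by rw [← sum_map_pow_eq_sum_count subset_s, ← sum_map_pow_eq_sum_count subset_t,
        h (n + 1) n.succ_pos]) (Finset.mem_insert_self _ _) ha
  simpa [ha] using count_eq

section NonzeroEigenvalues

variable {ι κ τ : Type*} [Fintype ι] [DecidableEq ι] [Fintype κ] [DecidableEq κ]
  [Fintype τ] [DecidableEq τ]

/-- The multiset of nonzero eigenvalues of a matrix, with algebraic multiplicities; over an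
algebraically closed field of characteristic zero it carries the same information as the traces of
the positive powers of the matrix. -/
noncomputable def nonzeroEigenvalues (T : Matrix ι ι K) : Multiset K :=
  T.charpoly.roots.filter (· ≠ 0)

variable [IsAlgClosed K]

theorem card_nonzeroEigenvalues (T : Matrix ι ι K) {m : ℕ} (hm : Fintype.card ι ≤ m) :
    (nonzeroEigenvalues T).card = (T ^ m).rank := by
  have ker_pow : LinearMap.ker (T.toLin' ^ m) = End.maxGenEigenspace T.toLin' 0 := by
    rw [End.maxGenEigenspace_eq_genEigenspace_finrank,
      ← End.genEigenspace_eq_genEigenspace_finrank_of_le _ _ (k := m) (by simpa using hm),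
      End.genEigenspace_nat, zero_smul, sub_zero]
  have rank_add : (T ^ m).rank + T.charpoly.roots.count 0 = Fintype.card ι := by
    rw [count_roots, ← charpoly_toLin', ← LinearMap.finrank_maxGenEigenspace_eq, ← ker_pow,
      ← finrank_fintype_fun_eq_card K, ← LinearMap.finrank_range_add_finrank_ker (T.toLin' ^ m),
      ← toLin'_pow]
    rfl
  have card_roots : T.charpoly.roots.card = Fintype.card ι := by
    rw [IsAlgClosed.card_roots_eq_natDegree, charpoly_natDegree_eq_dim]
  have card_add := congrArg Multiset.card (Multiset.filter_add_not (· = 0) T.charpoly.roots)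
  rw [Multiset.card_add, Multiset.filter_eq', Multiset.card_replicate] at card_add
  simp only [nonzeroEigenvalues, ne_eq]
  omega

variable [CharZero K]

theorem nonzeroEigenvalues_eq_of_trace_pow {T : Matrix ι ι K} {S : Matrix κ κ K}
    (h : ∀ k, 1 ≤ k → (T ^ k).trace = (S ^ k).trace) :
    nonzeroEigenvalues T = nonzeroEigenvalues S :=
  filter_ne_zero_eq_of_sum_map_pow_eq fun k hk => by
    rw [← trace_pow_eq_sum_roots_charpoly, ← trace_pow_eq_sum_roots_charpoly, h k hk]

theorem nonzeroEigenvalues_eq_add_of_trace_pow {T : Matrix ι ι K} {S : Matrix κ κ K}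
    {U : Matrix τ τ K} (h : ∀ k, 1 ≤ k → (T ^ k).trace = (S ^ k).trace + (U ^ k).trace) :
    nonzeroEigenvalues T = nonzeroEigenvalues S + nonzeroEigenvalues U := by
  rw [nonzeroEigenvalues, nonzeroEigenvalues, nonzeroEigenvalues, ← Multiset.filter_add]
  refine filter_ne_zero_eq_of_sum_map_pow_eq fun k hk => ?_
  rw [Multiset.map_add, Multiset.sum_add, ← trace_pow_eq_sum_roots_charpoly,
    ← trace_pow_eq_sum_roots_charpoly, ← trace_pow_eq_sum_roots_charpoly, h k hk]

theorem nonzeroEigenvalues_pow (T : Matrix ι ι K) {k : ℕ} (hk : k ≠ 0) :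
    nonzeroEigenvalues (T ^ k) = (nonzeroEigenvalues T).map (· ^ k) := by
  have map_filter : (nonzeroEigenvalues T).map (· ^ k) =
      (T.charpoly.roots.map (· ^ k)).filter (· ≠ 0) := by
    rw [Multiset.filter_map, nonzeroEigenvalues]
    simp only [Function.comp_def, ne_eq, pow_eq_zero_iff hk]
  rw [map_filter]
  refine filter_ne_zero_eq_of_sum_map_pow_eq fun j _ => ?_
  rw [← trace_pow_eq_sum_roots_charpoly, Multiset.map_map, ← pow_mul,
    trace_pow_eq_sum_roots_charpoly]
  simp only [Function.comp_def, pow_mul]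

end NonzeroEigenvalues

end Spectra

section DominantEigenvalue

open Polynomial

theorem hasUniqueLargestEigenvalue_iff {n : ℕ} (T : Matrix (Fin n) (Fin n) ℂ) :
    HasUniqueLargestEigenvalue T ↔ ∃ r : ℝ, 0 < r ∧ (nonzeroEigenvalues T).count (r : ℂ) = 1 ∧
      ∀ z ∈ nonzeroEigenvalues T, z ≠ r → ‖z‖ < r := by
  refine exists_congr fun r => and_congr_right fun hr => and_congr ?_ (forall_congr' fun z => ?_)
  · have hr0 : (r : ℂ) ≠ 0 := Complex.ofReal_ne_zero.2 hr.ne'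
    rw [nonzeroEigenvalues, Multiset.count_filter_of_pos (p := (· ≠ 0)) hr0, count_roots]
  · rw [nonzeroEigenvalues, Multiset.mem_filter, mem_roots (charpoly_monic T).ne_zero, and_imp]
    refine forall_congr' fun _ => ⟨fun h _ => h, fun h hz => ?_⟩
    rcases eq_or_ne z 0 with rfl | hz0
    · rwa [norm_zero]
    · exact h hz0 hz

theorem HasUniqueLargestEigenvalue.congr {n m : ℕ} {T : Matrix (Fin n) (Fin n) ℂ}
    {S : Matrix (Fin m) (Fin m) ℂ} (hT : HasUniqueLargestEigenvalue T)
    (h : nonzeroEigenvalues T = nonzeroEigenvalues S) : HasUniqueLargestEigenvalue S := by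
  rw [hasUniqueLargestEigenvalue_iff] at hT ⊢
  rwa [← h]

theorem HasUniqueLargestEigenvalue.pow {n : ℕ} {T : Matrix (Fin n) (Fin n) ℂ}
    (hT : HasUniqueLargestEigenvalue T) {k : ℕ} (hk : k ≠ 0) :
    HasUniqueLargestEigenvalue (T ^ k) := by
  rw [hasUniqueLargestEigenvalue_iff] at hT ⊢
  obtain ⟨r, hr, simple, others_lt⟩ := hT
  rw [nonzeroEigenvalues_pow T hk]
  have norm_pow_lt : ∀ z ∈ nonzeroEigenvalues T, z ≠ r → ‖z ^ k‖ < r ^ k := fun z hz hzr => by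
    rw [norm_pow]
    exact pow_lt_pow_left₀ (others_lt z hz hzr) (norm_nonneg z) hk
  refine ⟨r ^ k, pow_pos hr k, ?_, fun w hw hwr => ?_⟩
  · rw [Complex.ofReal_pow, Multiset.count_map, ← simple, Multiset.count_eq_card_filter_eq]
    congr 1
    refine Multiset.filter_congr fun z hz => ⟨fun h => ?_, fun h => by rw [h]⟩
    by_contra hne
    have := norm_pow_lt z hz (Ne.symm hne)
    rw [← h, norm_pow, Complex.norm_real, Real.norm_of_nonneg hr.le] at this
    exact lt_irrefl _ this
  · obtain ⟨z, hz, rfl⟩ := Multiset.mem_map.1 hw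
    refine norm_pow_lt z hz ?_
    rintro rfl
    exact hwr (Complex.ofReal_pow r k).symm

theorem exists_dual_of_finrank_maxGenEigenspace_eq_one {K V : Type*} [Field K] [AddCommGroup V]
    [Module K V] [FiniteDimensional K V] {f : End K V} {μ : K}
    (h : finrank K (f.maxGenEigenspace μ) = 1) :
    ∃ (v : V) (φ : Dual K V), f.eigenspace μ = K ∙ v ∧ φ v = 1 ∧ φ ∘ₗ f = μ • φ := by
  have hasEigenvalue : f.HasEigenvalue μ := by
    rw [End.hasEigenvalue_iff_isRoot_charpoly,
      ← Polynomial.rootMultiplicity_pos (LinearMap.charpoly_monic f).ne_zero,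
      ← LinearMap.finrank_maxGenEigenspace_eq, h]
    exact one_pos
  obtain ⟨v, hv⟩ := hasEigenvalue.exists_hasEigenvector
  have span_eq : f.maxGenEigenspace μ = K ∙ v := by
    refine (Submodule.eq_of_le_of_finrank_le ?_ ?_).symm
    · exact (Submodule.span_singleton_le_iff_mem _ _).2
        (End.genEigenspace_le_maximal f μ 1 hv.1)
    · rw [h, finrank_span_singleton hv.2]
  have eigenspace_eq : f.eigenspace μ = K ∙ v :=
    le_antisymm (span_eq ▸ End.genEigenspace_le_maximal f μ 1)
      ((Submodule.span_singleton_le_iff_mem _ _).2 hv.1)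
  have notMem_range : v ∉ LinearMap.range (f - algebraMap K _ μ) := by
    rintro ⟨u, hu⟩
    have hu' : u ∈ f.eigenspace μ := by
      rw [eigenspace_eq, ← span_eq, End.mem_maxGenEigenspace]
      refine ⟨2, ?_⟩
      rw [← Algebra.algebraMap_eq_smul_one, pow_two, End.mul_apply, hu]
      simpa [sub_eq_zero] using hv.apply_eq_smul
    refine hv.2 (hu.symm.trans ?_)
    simpa [sub_eq_zero] using End.mem_eigenspace_iff.1 hu'
  obtain ⟨φ, hφv, hφ⟩ := Submodule.exists_le_ker_of_notMem notMem_range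
  refine ⟨v, (φ v)⁻¹ • φ, eigenspace_eq, inv_mul_cancel₀ hφv, LinearMap.ext fun w => ?_⟩
  have : φ (f w) = μ * φ w := by
    simpa [sub_eq_zero] using hφ (LinearMap.mem_range_self (f - algebraMap K _ μ) w)
  simp only [LinearMap.comp_apply, LinearMap.smul_apply, smul_eq_mul, this]
  ring

theorem exists_eigenvectors_of_rootMultiplicity_eq_one {K ι : Type*} [Field K] [Fintype ι]
    [DecidableEq ι] {T : Matrix ι ι K} {μ : K} (h : T.charpoly.rootMultiplicity μ = 1) :
    ∃ R L : ι → K, T *ᵥ R = μ • R ∧ L ᵥ* T = μ • L ∧ L ⬝ᵥ R = 1 ∧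
      ∀ v, T *ᵥ v = μ • v → ∃ c : K, v = c • R := by
  rw [← charpoly_toLin', ← LinearMap.finrank_maxGenEigenspace_eq] at h
  obtain ⟨R, φ, eigenspace_eq, hφR, hφ⟩ := exists_dual_of_finrank_maxGenEigenspace_eq_one h
  obtain ⟨L, rfl⟩ := (dotProductEquiv K ι).surjective φ
  have mem_iff (v : ι → K) : T *ᵥ v = μ • v ↔ v ∈ K ∙ R := by
    rw [← eigenspace_eq, End.mem_eigenspace_iff, toLin'_apply]
  refine ⟨R, L, (mem_iff R).2 (Submodule.mem_span_singleton_self R), ?_, hφR, fun v hv => ?_⟩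
  · refine dotProduct_eq _ _ fun v => ?_
    rw [← dotProduct_mulVec]
    simpa using LinearMap.congr_fun hφ v
  · obtain ⟨c, hc⟩ := Submodule.mem_span_singleton.1 ((mem_iff v).1 hv)
    exact ⟨c, hc.symm⟩

theorem tendsto_pow_zero_of_spectralRadius_lt_one {A : Type*} [NormedRing A] [NormedAlgebra ℂ A]
    [CompleteSpace A] {a : A} (ha : spectralRadius ℂ a < 1) :
    Filter.Tendsto (a ^ ·) Filter.atTop (nhds 0) := by
  obtain ⟨q, ha_lt, hq_lt⟩ := ENNReal.lt_iff_exists_nnreal_btwn.1 ha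
  have gelfand :=
    (spectrum.pow_nnnorm_pow_one_div_tendsto_nhds_spectralRadius a).eventually_lt_const ha_lt
  refine squeeze_zero_norm' ?_ (tendsto_pow_atTop_nhds_zero_of_lt_one q.2 (by exact_mod_cast hq_lt))
  filter_upwards [gelfand, Filter.eventually_ne_atTop 0] with k hk hk0
  rw [one_div, ENNReal.rpow_inv_lt_iff (by positivity), ENNReal.rpow_natCast] at hk
  exact_mod_cast hk.le

section

attribute [local instance] Matrix.linftyOpNormedRing Matrix.linftyOpNormedAlgebra

theorem tendsto_pow_zero_of_norm_eigenvalue_lt_one {ι : Type*} [Fintype ι] [DecidableEq ι]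
    {M : Matrix ι ι ℂ} (h : ∀ z : ℂ, ∀ v ≠ 0, M *ᵥ v = z • v → ‖z‖ < 1) :
    Filter.Tendsto (M ^ ·) Filter.atTop (nhds 0) := by
  rcases isEmpty_or_nonempty ι
  · exact tendsto_const_nhds.congr fun k => Subsingleton.elim _ _
  refine tendsto_pow_zero_of_spectralRadius_lt_one ?_
  refine spectrum.spectralRadius_lt_of_forall_lt (r := 1) M fun z hz => ?_
  rw [← spectrum_toLin', ← End.hasEigenvalue_iff_mem_spectrum] at hz
  obtain ⟨v, hv⟩ := hz.exists_hasEigenvector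
  exact h z v hv.2 hv.apply_eq_smul

end

theorem sub_pow_of_mul_eq {A : Type*} [Ring A] {s e : A} (hse : s * e = e) (hes : e * s = e)
    (he : e * e = e) {k : ℕ} (hk : k ≠ 0) : (s - e) ^ k = s ^ k - e := by
  have pow_mul_eq (j : ℕ) : s ^ j * e = e := by
    induction j with
    | zero => rw [pow_zero, one_mul]
    | succ j ih => rw [pow_succ, mul_assoc, hse, ih]
  induction k, Nat.one_le_iff_ne_zero.2 hk using Nat.le_induction with
  | base => rw [pow_one, pow_one]
  | succ k hk ih =>
    rw [pow_succ, ih (by omega), sub_mul, mul_sub, mul_sub, ← pow_succ, pow_mul_eq, hes, he,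
      sub_self, sub_zero]

section Eigenprojection

variable {ι : Type*} [Fintype ι] [DecidableEq ι] {T : Matrix ι ι ℂ} {R L : ι → ℂ} {r : ℝ}

theorem norm_eigenvalue_sub_eigenprojection_lt (hr : 0 < r) (hL : L ᵥ* T = (r : ℂ) • L)
    (hLR : L ⬝ᵥ R = 1) (hker : ∀ v, T *ᵥ v = (r : ℂ) • v → ∃ c : ℂ, v = c • R)
    (hlt : ∀ z ∈ nonzeroEigenvalues T, z ≠ r → ‖z‖ < r) {z : ℂ} {v : ι → ℂ} (hv : v ≠ 0)
    (hzv : (T - (r : ℂ) • vecMulVec R L) *ᵥ v = z • v) : ‖z‖ < r := by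
  have apply_eq (w : ι → ℂ) :
      (T - (r : ℂ) • vecMulVec R L) *ᵥ w = T *ᵥ w - (r : ℂ) • (L ⬝ᵥ w) • R := by
    rw [sub_mulVec, smul_mulVec, vecMulVec_mulVec, op_smul_eq_smul]
  rw [apply_eq] at hzv
  rcases eq_or_ne z 0 with rfl | hz
  · rwa [norm_zero]
  have hLv : L ⬝ᵥ v = 0 := by
    have := congrArg (L ⬝ᵥ ·) hzv
    simp only [dotProduct_sub, dotProduct_smul, dotProduct_mulVec, hL, smul_dotProduct, hLR,
      smul_eq_mul, mul_one, sub_self] at this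
    exact (mul_eq_zero.1 this.symm).resolve_left hz
  rw [hLv, zero_smul, smul_zero, sub_zero] at hzv
  refine hlt z (Multiset.mem_filter.2 ⟨?_, hz⟩) ?_
  · rw [mem_roots (charpoly_monic T).ne_zero, ← mem_spectrum_iff_isRoot_charpoly,
      ← spectrum_toLin', ← End.hasEigenvalue_iff_mem_spectrum]
    exact End.hasEigenvalue_of_hasEigenvector ⟨End.mem_eigenspace_iff.2 hzv, hv⟩
  · rintro rfl
    obtain ⟨c, rfl⟩ := hker v hzv
    rw [dotProduct_smul, hLR, smul_eq_mul, mul_one] at hLv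
    exact hv (by rw [hLv, zero_smul])

theorem tendsto_pow_eigenprojection (hr : 0 < r) (hR : T *ᵥ R = (r : ℂ) • R)
    (hL : L ᵥ* T = (r : ℂ) • L) (hLR : L ⬝ᵥ R = 1)
    (hker : ∀ v, T *ᵥ v = (r : ℂ) • v → ∃ c : ℂ, v = c • R)
    (hlt : ∀ z ∈ nonzeroEigenvalues T, z ≠ r → ‖z‖ < r) :
    Filter.Tendsto (fun k : ℕ => ((r : ℂ)⁻¹ • T) ^ k) Filter.atTop (nhds (vecMulVec R L)) := by
  have hr0 : (r : ℂ) ≠ 0 := Complex.ofReal_ne_zero.2 hr.ne'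
  set E := vecMulVec R L with hE
  have hSE : (r : ℂ)⁻¹ • T * E = E := by
    rw [hE, Matrix.smul_mul, mul_vecMulVec, hR, smul_vecMulVec, inv_smul_smul₀ hr0]
  have hES : E * (r : ℂ)⁻¹ • T = E := by
    rw [hE, Matrix.mul_smul, vecMulVec_mul, hL, vecMulVec_smul, inv_smul_smul₀ hr0]
  have hEE : E * E = E := by rw [hE, vecMulVec_mul_vecMulVec, hLR, one_smul]
  have remainder : Filter.Tendsto (fun k : ℕ => ((r : ℂ)⁻¹ • T - E) ^ k) Filter.atTop (nhds 0) := by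
    refine tendsto_pow_zero_of_norm_eigenvalue_lt_one fun z v hv hzv => ?_
    have hrz : ‖(r : ℂ) * z‖ < r := by
      refine norm_eigenvalue_sub_eigenprojection_lt hr hL hLR hker hlt hv ?_
      rw [mul_smul, ← hzv, ← smul_mulVec, smul_sub, smul_inv_smul₀ hr0]
    rw [norm_mul, Complex.norm_real, Real.norm_of_nonneg hr.le] at hrz
    exact lt_of_mul_lt_mul_left (by rwa [mul_one]) hr.le
  have limit := remainder.add_const E
  rw [zero_add] at limit
  refine limit.congr' ?_
  filter_upwards [Filter.eventually_ne_atTop 0] with k hk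
  rw [sub_pow_of_mul_eq hSE hES hEE hk, sub_add_cancel]

end Eigenprojection

theorem HasUniqueLargestEigenvalue.exists_tendsto_pow {n : ℕ} {T : Matrix (Fin n) (Fin n) ℂ}
    (hT : HasUniqueLargestEigenvalue T) :
    ∃ (r : ℂ) (R L : Fin n → ℂ), r ≠ 0 ∧ T *ᵥ R = r • R ∧ L ᵥ* T = r • L ∧ L ⬝ᵥ R = 1 ∧
      Filter.Tendsto (fun k : ℕ => (r⁻¹ • T) ^ k) Filter.atTop (nhds (vecMulVec R L)) := by
  obtain ⟨r, hr, simple, others_lt⟩ := (hasUniqueLargestEigenvalue_iff T).1 hT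
  have hr0 : (r : ℂ) ≠ 0 := Complex.ofReal_ne_zero.2 hr.ne'
  rw [nonzeroEigenvalues, Multiset.count_filter_of_pos (p := (· ≠ 0)) hr0, count_roots] at simple
  obtain ⟨R, L, hR, hL, hLR, hker⟩ := exists_eigenvectors_of_rootMultiplicity_eq_one simple
  exact ⟨r, R, L, hr0, hR, hL, hLR, tendsto_pow_eigenprojection hr hR hL hLR hker others_lt⟩

end DominantEigenvalue

section Irreducible

variable {K ι : Type*} [Field K] [Fintype ι] {S : Submodule K (Matrix ι ι K)}

/-- A space of matrices acts irreducibly if it leaves no proper nonzero subspace invariant. On the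
zero-dimensional space every `S` acts irreducibly. -/
def ActsIrreducibly (S : Submodule K (Matrix ι ι K)) : Prop :=
  ∀ W : Submodule K (ι → K), (∀ M ∈ S, ∀ v ∈ W, M *ᵥ v ∈ W) → W = ⊥ ∨ W = ⊤

theorem ActsIrreducibly.map_transpose (hS : ActsIrreducibly S) :
    ActsIrreducibly (S.map (transposeLinearEquiv ι ι K K).toLinearMap) := by
  classical
  intro W hW
  have invariant : ∀ M ∈ S, ∀ v ∈ W.orthogonalBilin (dotProductBilin K K),
      M *ᵥ v ∈ W.orthogonalBilin (dotProductBilin K K) := by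
    intro M hM v hv l hl
    have : Mᵀ *ᵥ l ⬝ᵥ v = 0 := hv _ (hW Mᵀ ⟨M, hM, rfl⟩ l hl)
    rwa [mulVec_transpose, ← dotProduct_mulVec] at this
  rcases hS _ invariant with h | h
  · right
    by_contra hne
    obtain ⟨f, hf, hle⟩ := W.exists_le_ker_of_lt_top (lt_top_iff_ne_top.2 hne)
    obtain ⟨u, rfl⟩ := (dotProductEquiv K ι).surjective f
    have u_mem : u ∈ W.orthogonalBilin (dotProductBilin K K) := fun l hl =>
      (dotProduct_comm l u).trans (hle hl)
    rw [h, Submodule.mem_bot] at u_mem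
    exact hf (by rw [u_mem, map_zero])
  · left
    refine (Submodule.eq_bot_iff W).2 fun l hl => dotProduct_eq_zero l fun v => ?_
    exact (h ▸ Submodule.mem_top : v ∈ W.orthogonalBilin (dotProductBilin K K)) l hl

variable [DecidableEq ι]

theorem ActsIrreducibly.exists_pow_mulVec_eq (hS : ActsIrreducibly S) {T : Matrix ι ι K}
    (hTS : T ∈ S) {R : ι → K} {r : K} (hr : r ≠ 0) (hR0 : R ≠ 0) (hR : T *ᵥ R = r • R) :
    ∃ a : ℕ, ∀ w, ∃ M ∈ S ^ a, M *ᵥ R = w := by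
  let orbit : ℕ →o Submodule K (ι → K) :=
    { toFun a := (S ^ a).map ((mulVecBilin K K).flip R)
      monotone' := monotone_nat_of_le_succ fun a => by
        rintro _ ⟨M, hM, rfl⟩
        refine ⟨r⁻¹ • (M * T),
          (S ^ (a + 1)).smul_mem _ (pow_succ S a ▸ Submodule.mul_mem_mul hM hTS), ?_⟩
        change (r⁻¹ • (M * T)) *ᵥ R = M *ᵥ R
        rw [smul_mulVec, ← mulVec_mulVec, hR, mulVec_smul, inv_smul_smul₀ hr] }
  obtain ⟨a, ha⟩ := monotone_stabilizes_iff_noetherian.2 inferInstance orbit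
  have invariant : ∀ M ∈ S, ∀ v ∈ orbit a, M *ᵥ v ∈ orbit a := by
    rintro M hM _ ⟨P, hP, rfl⟩
    rw [ha (a + 1) a.le_succ]
    exact ⟨M * P, pow_succ' S a ▸ Submodule.mul_mem_mul hM hP, (mulVec_mulVec R M P).symm⟩
  have R_mem : R ∈ orbit a := orbit.monotone a.zero_le
    ⟨1, pow_zero S ▸ Submodule.one_le.1 le_rfl, one_mulVec R⟩
  have orbit_eq_top : orbit a = ⊤ := (hS _ invariant).resolve_left fun h =>
    hR0 ((Submodule.mem_bot K).1 (h ▸ R_mem))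
  exact ⟨a, fun w => (orbit_eq_top ▸ Submodule.mem_top : w ∈ orbit a)⟩

theorem transpose_mem_pow_of_mem_map_transpose_pow (a : ℕ) {M : Matrix ι ι K}
    (hM : M ∈ S.map (transposeLinearEquiv ι ι K K).toLinearMap ^ a) : Mᵀ ∈ S ^ a := by
  suffices h : S.map (transposeLinearEquiv ι ι K K).toLinearMap ^ a ≤
      (S ^ a).comap (transposeLinearEquiv ι ι K K).toLinearMap from h hM
  clear hM
  induction a with
  | zero =>
    rw [pow_zero, pow_zero, Submodule.one_le]
    exact transpose_one (n := ι) (α := K) ▸ Submodule.one_le.1 le_rfl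
  | succ a ih =>
    rw [pow_succ', pow_succ, Submodule.mul_le]
    rintro _ ⟨P, hP, rfl⟩ Q hQ
    change (Pᵀ * Q)ᵀ ∈ S ^ a * S
    exact (transpose_mul Pᵀ Q).symm ▸ Submodule.mul_mem_mul (ih hQ) hP

theorem ActsIrreducibly.exists_pow_vecMul_eq (hS : ActsIrreducibly S) {T : Matrix ι ι K}
    (hTS : T ∈ S) {L : ι → K} {r : K} (hr : r ≠ 0) (hL0 : L ≠ 0) (hL : L ᵥ* T = r • L) :
    ∃ b : ℕ, ∀ w, ∃ M ∈ S ^ b, L ᵥ* M = w := by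
  obtain ⟨b, hb⟩ := hS.map_transpose.exists_pow_mulVec_eq ⟨T, hTS, rfl⟩ hr hL0
    ((mulVec_transpose T L).trans hL)
  refine ⟨b, fun w => ?_⟩
  obtain ⟨M, hM, rfl⟩ := hb w
  exact ⟨Mᵀ, transpose_mem_pow_of_mem_map_transpose_pow b hM, vecMul_transpose M L⟩

end Irreducible

section Primitivity

section

attribute [local instance] Matrix.linftyOpNormedAddCommGroup Matrix.linftyOpNormedSpace

theorem eventually_span_eq_top_of_tendsto_single {ι : Type*} [Finite ι] [DecidableEq ι]
    {F : ℕ → ι × ι → Matrix ι ι ℂ}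
    (hF : ∀ p, Filter.Tendsto (F · p) Filter.atTop (nhds (single p.1 p.2 1))) :
    ∀ᶠ k in Filter.atTop, Submodule.span ℂ (Set.range (F k)) = ⊤ := by
  cases nonempty_fintype ι
  have units_linearIndependent : LinearIndependent ℂ fun p : ι × ι =>
      (single p.1 p.2 1 : Matrix ι ι ℂ) := by
    simpa only [← stdBasis_eq_single] using (stdBasis ℂ ι ι).linearIndependent
  filter_upwards [(tendsto_pi_nhds.2 hF).eventually units_linearIndependent.eventually] with k hk
  exact hk.span_eq_top_of_card_eq_finrank' (by simp [finrank_matrix])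

end

variable {ι : Type*} [Fintype ι] [DecidableEq ι]

theorem ActsIrreducibly.exists_forall_pow_eq_top {S : Submodule ℂ (Matrix ι ι ℂ)}
    (hS : ActsIrreducibly S) {T : Matrix ι ι ℂ} (hTS : T ∈ S) {r : ℂ} {R L : ι → ℂ} (hr : r ≠ 0)
    (hR : T *ᵥ R = r • R) (hL : L ᵥ* T = r • L) (hLR : L ⬝ᵥ R = 1)
    (hlim : Filter.Tendsto (fun k : ℕ => (r⁻¹ • T) ^ k) Filter.atTop (nhds (vecMulVec R L))) :
    ∃ l : ℕ, ∀ k, l ≤ k → S ^ k = ⊤ := by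
  obtain ⟨a, ha⟩ := hS.exists_pow_mulVec_eq hTS hr (fun h => by simp [h] at hLR) hR
  obtain ⟨b, hb⟩ := hS.exists_pow_vecMul_eq hTS hr (fun h => by simp [h] at hLR) hL
  choose M hM hMR using fun i => ha (Pi.single i 1)
  choose N hN hNL using fun i => hb (Pi.single i 1)
  -- `M i * R Lᵀ * N j` is the matrix unit `E i j`.
  have tendsto_unit (p : ι × ι) : Filter.Tendsto (fun k => M p.1 * (r⁻¹ • T) ^ k * N p.2)
      Filter.atTop (nhds (single p.1 p.2 1)) := by
    have := (hlim.const_mul (M p.1)).mul_const (N p.2)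
    rwa [mul_vecMulVec, vecMulVec_mul, hMR, hNL, ← single_eq_single_vecMulVec_single] at this
  obtain ⟨l, hl⟩ := Filter.eventually_atTop.1
    (eventually_span_eq_top_of_tendsto_single tendsto_unit)
  refine ⟨a + l + b, fun k hk => ?_⟩
  obtain ⟨m, hm, rfl⟩ : ∃ m, l ≤ m ∧ k = a + m + b := ⟨k - a - b, by lia, by lia⟩
  rw [eq_top_iff, ← hl m hm, Submodule.span_le, pow_add, pow_add]
  rintro _ ⟨p, rfl⟩
  exact Submodule.mul_mem_mul (Submodule.mul_mem_mul (hM p.1)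
    (Submodule.pow_mem_pow S (S.smul_mem _ hTS) m)) (hN p.2)

end Primitivity

section Pairing

variable {R κ : Type*} [CommSemiring R] [Fintype κ]

/-- The bilinear pairing of two operators through their matrix entries. -/
def pairing : Matrix κ κ R →ₗ[R] Matrix κ κ R →ₗ[R] R :=
  LinearMap.mk₂ R (fun f X => ∑ s : κ × κ, f s.1 s.2 * X s.1 s.2)
    (fun f g X => by simp only [Matrix.add_apply, add_mul, Finset.sum_add_distrib])
    (fun c f X => by simp only [Matrix.smul_apply, smul_eq_mul, mul_assoc, Finset.mul_sum])
    (fun f X Y => by simp only [Matrix.add_apply, mul_add, Finset.sum_add_distrib])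
    fun c f X => by simp only [Matrix.smul_apply, smul_eq_mul, mul_left_comm, Finset.mul_sum]

theorem pairing_apply (f X : Matrix κ κ R) :
    pairing f X = ∑ s : κ × κ, f s.1 s.2 * X s.1 s.2 := rfl

theorem pairing_comm (f X : Matrix κ κ R) : pairing f X = pairing X f :=
  Finset.sum_congr rfl fun _ _ => mul_comm _ _

theorem pairing_single_right [DecidableEq κ] (f : Matrix κ κ R) (i j : κ) :
    pairing f (single i j 1) = f i j := by
  rw [pairing_apply, Fintype.sum_prod_type]
  simp [single_apply, ite_and]

theorem pairing_one_left [DecidableEq κ] (X : Matrix κ κ R) : pairing 1 X = X.trace := by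
  rw [pairing_apply, Fintype.sum_prod_type]
  simp [one_apply, trace]

theorem pairing_injective : Function.Injective (pairing : Matrix κ κ R →ₗ[R] _) :=
  fun f g h => by classical ext i j; rw [← pairing_single_right f, h, pairing_single_right]

theorem pairing_surjective (φ : Dual R (Matrix κ κ R)) : ∃ f, pairing f = φ := by
  classical
  refine ⟨of fun i j => φ (single i j 1), ext_linearMap R fun i j => LinearMap.ext_ring ?_⟩
  exact pairing_single_right _ i j

end Pairing

section BlockTriangular

variable {R m n : Type*} [Fintype m] [Fintype n] [DecidableEq m] [DecidableEq n]

theorem toBlocks_prod_of_toBlocks₂₁_eq_zero [Semiring R] :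
    ∀ l : List (Matrix (m ⊕ n) (m ⊕ n) R), (∀ M ∈ l, M.toBlocks₂₁ = 0) →
      l.prod.toBlocks₁₁ = (l.map toBlocks₁₁).prod ∧ l.prod.toBlocks₂₁ = 0 ∧
        l.prod.toBlocks₂₂ = (l.map toBlocks₂₂).prod
  | [], _ => by simp [← fromBlocks_one]
  | M :: l, h => by
    obtain ⟨hM, hl⟩ := List.forall_mem_cons.1 h
    obtain ⟨h₁₁, h₂₁, h₂₂⟩ := toBlocks_prod_of_toBlocks₂₁_eq_zero l hl
    rw [List.prod_cons, ← fromBlocks_toBlocks M, ← fromBlocks_toBlocks l.prod, fromBlocks_multiply]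
    simp [h₁₁, h₂₁, h₂₂, hM]

theorem trace_prod_of_toBlocks₂₁_eq_zero [Semiring R] {l : List (Matrix (m ⊕ n) (m ⊕ n) R)}
    (hl : ∀ M ∈ l, M.toBlocks₂₁ = 0) :
    l.prod.trace = (l.map toBlocks₁₁).prod.trace + (l.map toBlocks₂₂).prod.trace := by
  obtain ⟨h₁₁, -, h₂₂⟩ := toBlocks_prod_of_toBlocks₂₁_eq_zero l hl
  rw [← h₁₁, ← h₂₂, trace, Fintype.sum_sum_type]
  rfl

end BlockTriangular

section Words

variable {σ R R' : Type*} [Monoid R] [Monoid R']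

/-- The product of the values of a two-index family `A` along a word of index pairs. -/
def wordProd (A : σ → σ → R) (w : List (σ × σ)) : R := (w.map fun s => A s.1 s.2).prod

theorem wordProd_ofFn (A : σ → σ → R) {n : ℕ} (w : Fin n → σ × σ) :
    wordProd A (List.ofFn w) = (List.ofFn fun x => A (w x).1 (w x).2).prod := by
  rw [wordProd, List.map_ofFn]
  rfl

theorem wordProd_comp (f : R →* R') (A : σ → σ → R) (w : List (σ × σ)) :
    wordProd (fun i j => f (A i j)) w = f (wordProd A w) := by
  rw [wordProd, wordProd, map_list_prod, List.map_map]
  rfl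

end Words

section Tensors

variable {σ : Type} {χ v u : ℕ}

/-- The span of the matrices of a tensor. -/
def tensorSpan (A : LocalTensor σ χ) : Submodule ℂ (Matrix (Fin χ) (Fin χ) ℂ) :=
  Submodule.span ℂ (Set.range fun s : σ × σ => A s.1 s.2)

theorem apply_mem_tensorSpan (A : LocalTensor σ χ) (i j : σ) : A i j ∈ tensorSpan A :=
  Submodule.subset_span ⟨(i, j), rfl⟩

/-- Traces of words add up: in traces, `A` is the direct sum of `B` and `C`. -/
def TraceSplits (A : LocalTensor σ χ) (B : LocalTensor σ v) (C : LocalTensor σ u) : Prop :=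
  ∀ w, (wordProd A w).trace = (wordProd B w).trace + (wordProd C w).trace

theorem traceSplits_toBlocks (A : LocalTensor σ χ)
    (E : Matrix (Fin χ) (Fin χ) ℂ →* Matrix (Fin v ⊕ Fin u) (Fin v ⊕ Fin u) ℂ)
    (hE : ∀ X, (E X).trace = X.trace) (hA : ∀ i j, (E (A i j)).toBlocks₂₁ = 0) :
    TraceSplits A (fun i j => (E (A i j)).toBlocks₁₁) fun i j => (E (A i j)).toBlocks₂₂ := by
  intro w
  rw [← hE, ← wordProd_comp, wordProd, trace_prod_of_toBlocks₂₁_eq_zero, List.map_map, List.map_map]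
  · rfl
  · simpa only [List.forall_mem_map] using fun (s : σ × σ) _ => hA s.1 s.2

theorem exists_traceSplits_of_basis (A : LocalTensor σ χ)
    (b : Basis (Fin v ⊕ Fin u) ℂ (Fin χ → ℂ))
    (hb : ∀ i j k l, b.repr (A i j *ᵥ b (Sum.inl k)) (Sum.inr l) = 0) :
    ∃ (B : LocalTensor σ v) (C : LocalTensor σ u), TraceSplits A B C := by
  let E := toLinAlgEquiv'.trans (LinearMap.toMatrixAlgEquiv b)
  refine ⟨_, _, traceSplits_toBlocks A (E : _ →* _) (fun X => ?_) fun i j => ?_⟩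
  · exact (LinearMap.trace_eq_matrix_trace ℂ b _).symm.trans (trace_toLin'_eq X)
  · ext l k
    exact (LinearMap.toMatrix_apply b b _ _ _).trans (hb i j k l)

theorem exists_traceSplits_of_invariant (A : LocalTensor σ χ) {W : Submodule ℂ (Fin χ → ℂ)}
    (hW : ∀ M ∈ tensorSpan A, ∀ x ∈ W, M *ᵥ x ∈ W) (hbot : W ≠ ⊥) (htop : W ≠ ⊤) :
    ∃ (v u : ℕ) (B : LocalTensor σ v) (C : LocalTensor σ u), v < χ ∧ u < χ ∧ TraceSplits A B C := by
  have finrank_add := W.finrank_quotient_add_finrank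
  have finrank_pos : 0 < finrank ℂ W :=
    Nat.pos_of_ne_zero fun h => hbot (Submodule.finrank_eq_zero.1 h)
  have finrank_lt := Submodule.finrank_lt htop
  rw [finrank_fin_fun] at finrank_add finrank_lt
  obtain ⟨B, C, h⟩ := exists_traceSplits_of_basis A
    (Basis.sumQuot (finBasis ℂ W) (finBasis ℂ ((Fin χ → ℂ) ⧸ W))) fun i j k l => by
      rw [Basis.sumQuot_repr_inr, Basis.sumQuot_inl, Submodule.mkQ_apply,
        (Submodule.Quotient.mk_eq_zero W).2
          (hW _ (apply_mem_tensorSpan A i j) _ (Submodule.coe_mem _)), map_zero,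
        Finsupp.zero_apply]
  exact ⟨_, _, B, C, finrank_lt, by lia, h⟩

theorem exists_traceSplits_directSum (B : LocalTensor σ v) (C : LocalTensor σ u) :
    ∃ D : LocalTensor σ (v + u), TraceSplits D B C := by
  let E := reindexAlgEquiv ℂ ℂ (finSumFinEquiv (m := v) (n := u)).symm
  let D : LocalTensor σ (v + u) := fun i j => E.symm (fromBlocks (B i j) 0 0 (C i j))
  have blocks (i j : σ) : E (D i j) = fromBlocks (B i j) 0 0 (C i j) := E.apply_symm_apply _
  have := traceSplits_toBlocks D (E : _ →* Matrix (Fin v ⊕ Fin u) (Fin v ⊕ Fin u) ℂ)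
    (fun X : Matrix (Fin (v + u)) _ ℂ => finSumFinEquiv.sum_comp X.diag) fun i j => by simp [blocks]
  exact ⟨D, by simpa [blocks] using this⟩

theorem virtualToPhysical_eq_pairing (A : LocalTensor σ χ) (X : Matrix (Fin χ) (Fin χ) ℂ)
    (i j : σ) : virtualToPhysical A X i j = pairing (A i j) X :=
  (Fintype.sum_prod_type' fun α β => A i j α β * X α β).symm

theorem injective_virtualToPhysical_iff (A : LocalTensor σ χ) :
    Function.Injective (virtualToPhysical A) ↔ tensorSpan A = ⊤ := by
  constructor
  · intro hA
    by_contra hne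
    obtain ⟨φ, hφ, hle⟩ := (tensorSpan A).exists_le_ker_of_lt_top (lt_top_iff_ne_top.2 hne)
    obtain ⟨X, rfl⟩ := pairing_surjective φ
    suffices h : X = 0 from hφ (h ▸ map_zero pairing)
    refine hA (Matrix.ext fun i j => ?_)
    rw [virtualToPhysical_eq_pairing, virtualToPhysical_eq_pairing, pairing_comm, map_zero]
    exact hle (apply_mem_tensorSpan A i j)
  · intro hA X Y hXY
    have le_ker : tensorSpan A ≤ LinearMap.ker (pairing X - pairing Y) := by
      rw [tensorSpan, Submodule.span_le]
      rintro _ ⟨s, rfl⟩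
      rw [SetLike.mem_coe, LinearMap.mem_ker, LinearMap.sub_apply, pairing_comm X, pairing_comm Y,
        ← virtualToPhysical_eq_pairing, ← virtualToPhysical_eq_pairing, hXY, sub_self]
    exact pairing_injective (sub_eq_zero.1 (LinearMap.ker_eq_top.1 (top_le_iff.1 (hA ▸ le_ker))))

variable [Fintype σ]

/-- The matrix obtained by contracting the physical indices of a tensor with a coefficient
function. -/
def contract (A : LocalTensor σ χ) : (σ × σ → ℂ) →ₗ[ℂ] Matrix (Fin χ) (Fin χ) ℂ :=
  Fintype.linearCombination ℂ fun s => A s.1 s.2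

theorem range_contract (A : LocalTensor σ χ) : LinearMap.range (contract A) = tensorSpan A :=
  Fintype.range_linearCombination ℂ _

theorem contract_surjective {A : LocalTensor σ χ} (h : tensorSpan A = ⊤) :
    Function.Surjective (contract A) :=
  LinearMap.range_eq_top.1 ((range_contract A).trans h)

theorem prod_ofFn_contract (A : LocalTensor σ χ) {n : ℕ} (a : Fin n → σ × σ → ℂ) :
    (List.ofFn fun x => contract A (a x)).prod =
      ∑ w : Fin n → σ × σ, (∏ x, a x (w x)) • wordProd A (List.ofFn w) := by
  have := (MultilinearMap.mkPiAlgebraFin ℂ n (Matrix (Fin χ) (Fin χ) ℂ)).map_sum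
    fun x (s : σ × σ) => a x s • A s.1 s.2
  simp only [MultilinearMap.map_smul_univ, MultilinearMap.mkPiAlgebraFin_apply, ← wordProd_ofFn]
    at this
  exact this

theorem TraceSplits.trace_prod_contract {A : LocalTensor σ χ} {B : LocalTensor σ v}
    {C : LocalTensor σ u} (h : TraceSplits A B C) {n : ℕ} (a : Fin n → σ × σ → ℂ) :
    (List.ofFn fun x => contract A (a x)).prod.trace =
      (List.ofFn fun x => contract B (a x)).prod.trace +
        (List.ofFn fun x => contract C (a x)).prod.trace := by
  simp only [prod_ofFn_contract, trace_sum, trace_smul, h _, smul_add, Finset.sum_add_distrib]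

section TransferMatrix

/-- The coefficient function of the trace. -/
def traceCoeff (σ : Type) [DecidableEq σ] (s : σ × σ) : ℂ := if s.1 = s.2 then 1 else 0

theorem contract_traceCoeff [DecidableEq σ] (A : LocalTensor σ χ) :
    contract A (traceCoeff σ) = transferMatrix A := by
  rw [contract, Fintype.linearCombination_apply, Fintype.sum_prod_type]
  simp [transferMatrix, traceCoeff]

theorem transferMatrix_mem_tensorSpan (A : LocalTensor σ χ) : transferMatrix A ∈ tensorSpan A :=
  Submodule.sum_mem _ fun i _ => apply_mem_tensorSpan A i i

theorem TraceSplits.nonzeroEigenvalues_transferMatrix {A : LocalTensor σ χ} {B : LocalTensor σ v}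
    {C : LocalTensor σ u} (h : TraceSplits A B C) :
    nonzeroEigenvalues (transferMatrix A) =
      nonzeroEigenvalues (transferMatrix B) + nonzeroEigenvalues (transferMatrix C) := by
  classical
  refine nonzeroEigenvalues_eq_add_of_trace_pow fun k _ => ?_
  simpa only [contract_traceCoeff, List.ofFn_const, List.prod_replicate] using
    h.trace_prod_contract fun _ : Fin k => traceCoeff σ

theorem exists_irreducible_traceSplits (A : LocalTensor σ χ) {r : ℂ}
    (hr : r ∈ nonzeroEigenvalues (transferMatrix A)) :
    ∃ (v u : ℕ) (B : LocalTensor σ v) (C : LocalTensor σ u), TraceSplits A B C ∧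
      ActsIrreducibly (tensorSpan B) ∧ r ∈ nonzeroEigenvalues (transferMatrix B) := by
  classical
  let IsComponentDim (v : ℕ) : Prop := ∃ (u : ℕ) (B : LocalTensor σ v) (C : LocalTensor σ u),
    TraceSplits A B C ∧ r ∈ nonzeroEigenvalues (transferMatrix B)
  have exists_dim : ∃ v, IsComponentDim v :=
    ⟨χ, 0, A, fun _ _ => 0, fun w => by simp [trace], hr⟩
  obtain ⟨u, B, C, hABC, hB⟩ := Nat.find_spec exists_dim
  refine ⟨_, u, B, C, hABC, fun W hW => ?_, hB⟩
  by_contra! hne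
  obtain ⟨v₁, v₂, B₁, B₂, hv₁, hv₂, hB₁₂⟩ := exists_traceSplits_of_invariant B hW hne.1 hne.2
  rw [hB₁₂.nonzeroEigenvalues_transferMatrix, Multiset.mem_add] at hB
  rcases hB with hB₁ | hB₂
  · obtain ⟨D, hD⟩ := exists_traceSplits_directSum B₂ C
    exact Nat.find_min exists_dim hv₁ ⟨_, B₁, D, fun w => by rw [hABC, hB₁₂, hD, add_assoc], hB₁⟩
  · obtain ⟨D, hD⟩ := exists_traceSplits_directSum B₁ C
    exact Nat.find_min exists_dim hv₂ ⟨_, B₂, D, fun w => by rw [hABC, hB₁₂, hD]; ring, hB₂⟩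

theorem exists_forall_tensorSpan_pow_eq_top {A : LocalTensor σ χ}
    (hA : ActsIrreducibly (tensorSpan A)) (hT : HasUniqueLargestEigenvalue (transferMatrix A)) :
    ∃ l : ℕ, ∀ k, l ≤ k → tensorSpan A ^ k = ⊤ := by
  obtain ⟨r, R, L, hr, hR, hL, hLR, hlim⟩ := hT.exists_tendsto_pow
  exact hA.exists_forall_pow_eq_top (transferMatrix_mem_tensorSpan A) hr hR hL hLR hlim

end TransferMatrix

end Tensors

section Arcs

variable {N n p : ℕ}

/-- The sites of a ring from `lo` up to and excluding `hi`, without wrapping around. -/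
def arc (N lo hi : ℕ) : Set (Fin N) := {s | lo ≤ s.1 ∧ s.1 < hi}

theorem arc_subset_arc {lo hi lo' hi' : ℕ} (hlo : lo' ≤ lo) (hhi : hi ≤ hi') :
    arc N lo hi ⊆ arc N lo' hi' :=
  fun _ hs => ⟨hlo.trans hs.1, hs.2.trans_le hhi⟩

theorem disjoint_arc {lo hi lo' hi' : ℕ} (h : hi ≤ lo') : Disjoint (arc N lo hi) (arc N lo' hi') :=
  Set.disjoint_left.2 fun _ hs hs' => (hs.2.trans_le h).not_ge hs'.1

/-- The sites of the `x`-th cell when a ring is divided into cells of `p` consecutive sites. -/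
def cell (N p x : ℕ) : Set (Fin N) := arc N (x * p) ((x + 1) * p)

theorem disjoint_cell {x y : ℕ} (hxy : x ≠ y) : Disjoint (cell N p x) (cell N p y) := by
  rcases lt_or_gt_of_ne hxy with h | h
  · exact disjoint_arc (Nat.mul_le_mul_right p h)
  · exact (disjoint_arc (Nat.mul_le_mul_right p h)).symm

/-- The position on the ring of a site given by its cell and its place in the cell. -/
def siteEquiv (h : n * p = N) : Fin n × Fin p ≃ Fin N := finProdFinEquiv.trans (finCongr h)

theorem siteEquiv_val (h : n * p = N) (x : Fin n) (y : Fin p) :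
    (siteEquiv h (x, y) : ℕ) = y + p * x := rfl

theorem siteEquiv_mem_cell_iff (h : n * p = N) {x x' : Fin n} {y : Fin p} :
    siteEquiv h (x, y) ∈ cell N p x' ↔ x = x' := by
  have self_mem : siteEquiv h (x, y) ∈ cell N p x := by
    have := y.2
    rw [cell, arc, Set.mem_ofPred_eq, siteEquiv_val, mul_comm p, add_mul]
    lia
  refine ⟨fun hmem => ?_, fun hx => hx ▸ self_mem⟩
  by_contra hne
  exact Set.disjoint_left.1 (disjoint_cell (Fin.val_ne_of_ne hne)) self_mem hmem

theorem exists_mem_cell (h : n * p = N) (s : Fin N) : ∃ x : Fin n, s ∈ cell N p x := by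
  obtain ⟨⟨x, y⟩, rfl⟩ := (siteEquiv h).surjective s
  exact ⟨x, (siteEquiv_mem_cell_iff h).2 rfl⟩

end Arcs

section Cells

variable {α : Type} {n k p N d χ v u : ℕ}

/-- A configuration of `n * p` sites as a configuration of `n` cells of `p` sites. -/
def cells (h : n * p = N) : (Fin N → α) ≃ (Fin n → Fin p → α) :=
  (Equiv.arrowCongr (siteEquiv h).symm (Equiv.refl α)).trans (Equiv.curry (Fin n) (Fin p) α)

theorem cells_eq_iff (h : n * p = N) (i i' : Fin N → α) (x : Fin n) :
    cells h i x = cells h i' x ↔ Set.EqOn i i' (cell N p x) := by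
  constructor
  · intro hx s hs
    obtain ⟨⟨x', y⟩, rfl⟩ := (siteEquiv h).surjective s
    obtain rfl := (siteEquiv_mem_cell_iff h).1 hs
    exact congrFun hx y
  · exact fun hi => funext fun y => hi ((siteEquiv_mem_cell_iff h).2 rfl)

theorem eqOn_compl_cell (h : n * p = N) {i i' : Fin N → α} {x : Fin n}
    (hi : ∀ y, y ≠ x → cells h i y = cells h i' y) : Set.EqOn i i' (cell N p x)ᶜ := by
  intro s hs
  obtain ⟨y, hy⟩ := exists_mem_cell h s
  exact (cells_eq_iff h i i' y).1 (hi y fun hyx => hs (hyx ▸ hy)) hy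

/-- A pair of configurations as a word of pairs of cell configurations. -/
def pairCells (h : n * p = N) :
    (Fin N → α) × (Fin N → α) ≃ (Fin n → (Fin p → α) × (Fin p → α)) :=
  ((cells h).prodCongr (cells h)).trans (Equiv.arrowProdEquivProdArrow _ _ _).symm

theorem pairCells_apply (h : n * p = N) (s : (Fin N → α) × (Fin N → α)) (x : Fin n) :
    pairCells h s x = (cells h s.1 x, cells h s.2 x) := rfl

/-- The translationally invariant operator generated by a tensor on a ring of `n` cells. -/
def ringOp (h : n * p = N) (A : LocalTensor (Fin p → α) χ) : ChainOp α N :=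
  of fun i j => (wordProd A (List.ofFn (pairCells h (i, j)))).trace

theorem mpdo_cells (h : n * p = N) (A : LocalTensor (Fin p → α) χ) (i j : Fin N → α) :
    mpdo A n (cells h i) (cells h j) = ringOp h A i j := by
  rw [ringOp, of_apply, wordProd_ofFn]
  rfl

theorem grouped_cells (ρ : ChainFamily d) (i j : Fin (n * p) → Fin d) :
    grouped p ρ n (cells rfl i) (cells rfl j) = ρ (n * p) i j := by
  have uncurry_cells (l : Fin (n * p) → Fin d) :
      (fun s => cells rfl l (finProdFinEquiv.symm s).1 (finProdFinEquiv.symm s).2) = l :=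
    funext fun s => congrArg l (finProdFinEquiv.apply_symm_apply s)
  rw [grouped, of_apply, uncurry_cells, uncurry_cells]

theorem generatedBy_iff {ρ : ChainFamily d} {A : LocalTensor (Fin p → Fin d) χ} :
    GeneratedBy ρ p A ↔ ∀ n N (h : n * p = N), 1 ≤ n → ρ N = ringOp h A := by
  constructor
  · rintro hρ n _ rfl hn
    ext i j
    rw [← grouped_cells ρ, hρ n hn, mpdo_cells]
  · intro hρ n hn
    ext i j
    obtain ⟨i, rfl⟩ := (cells rfl).surjective i
    obtain ⟨j, rfl⟩ := (cells rfl).surjective j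
    rw [mpdo_cells, grouped_cells, hρ n _ rfl hn]

section Blocking

/-- The tensor obtained by grouping `k` cells into one. -/
def blockTensor (k : ℕ) (A : LocalTensor (Fin p → α) χ) : LocalTensor (Fin (k * p) → α) χ :=
  fun i j => wordProd A (List.ofFn (pairCells rfl (i, j)))

theorem wordProd_blockTensor (A : LocalTensor (Fin p → α) χ)
    (w : List ((Fin (k * p) → α) × (Fin (k * p) → α))) :
    wordProd (blockTensor k A) w = wordProd A (w.flatMap fun s => List.ofFn (pairCells rfl s)) := by
  induction w with
  | nil => rfl
  | cons s w ih =>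
    simp only [wordProd, List.map_cons, List.prod_cons, List.flatMap_cons, List.map_append,
      List.prod_append] at ih ⊢
    rw [ih]
    rfl

theorem TraceSplits.blockTensor {A : LocalTensor (Fin p → α) χ} {B : LocalTensor (Fin p → α) v}
    {C : LocalTensor (Fin p → α) u} (h : TraceSplits A B C) (k : ℕ) :
    TraceSplits (blockTensor k A) (blockTensor k B) (blockTensor k C) := fun w => by
  rw [wordProd_blockTensor, wordProd_blockTensor, wordProd_blockTensor, h]

theorem cells_cells (h : n * (k * p) = N) (h' : n * k * p = N) (i : Fin N → α) (x : Fin n)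
    (y : Fin k) : cells rfl (cells h i x) y = cells h' i (siteEquiv rfl (x, y)) := by
  funext z
  refine congrArg i (Fin.ext ?_)
  change (z + p * y + k * p * x : ℕ) = z + p * (y + k * x)
  ring

theorem ringOp_blockTensor (h : n * (k * p) = N) (h' : n * k * p = N)
    (A : LocalTensor (Fin p → α) χ) : ringOp h (blockTensor k A) = ringOp h' A := by
  ext i j
  have word_eq : ((List.ofFn (pairCells h (i, j))).flatMap fun s => List.ofFn (pairCells rfl s)) =
      List.ofFn (pairCells h' (i, j)) := by
    rw [List.ofFn_mul, List.flatMap_def, List.map_ofFn]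
    refine congrArg List.flatten (congrArg List.ofFn (funext fun x => ?_))
    refine congrArg List.ofFn (funext fun y => ?_)
    simp only [pairCells_apply, cells_cells h h']
    have site_eq : siteEquiv rfl (x, y) = ⟨x * k + y, by nlinarith [x.2, y.2]⟩ :=
      Fin.ext (by rw [siteEquiv_val]; ring)
    rw [site_eq]
  rw [ringOp, ringOp, of_apply, of_apply, wordProd_blockTensor, word_eq]

theorem GeneratedBy.blockTensor {ρ : ChainFamily d} {A : LocalTensor (Fin p → Fin d) χ}
    (hρ : GeneratedBy ρ p A) (hk : 1 ≤ k) : GeneratedBy ρ (k * p) (blockTensor k A) := by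
  rw [generatedBy_iff] at hρ ⊢
  intro n N h hn
  rw [ringOp_blockTensor h (by rw [mul_assoc, h])]
  exact hρ _ _ _ (Nat.mul_pos hn hk)

theorem tensorSpan_blockTensor (A : LocalTensor (Fin p → α) χ) :
    tensorSpan (blockTensor k A) = tensorSpan A ^ k := by
  rw [tensorSpan, tensorSpan, Submodule.span_pow]
  congr 1
  ext M
  simp only [Set.mem_pow, Set.mem_range, blockTensor, Prod.mk.eta, wordProd_ofFn]
  constructor
  · rintro ⟨s, rfl⟩
    exact ⟨fun y => ⟨_, pairCells rfl s y, rfl⟩, rfl⟩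
  · rintro ⟨f, rfl⟩
    choose w hw using fun y => (f y).2
    exact ⟨(pairCells rfl).symm w, by simp only [Equiv.apply_symm_apply, hw]⟩

end Blocking

section ProductFunctionals

/-- The matrix whose entries are products over the cells of coefficient functions `a x`; paired
with an operator, it is a product functional. -/
def onCells (h : n * p = N) (a : Fin n → (Fin p → α) × (Fin p → α) → ℂ) : ChainOp α N :=
  of fun i j => ∏ x, a x (pairCells h (i, j) x)

/-- A coefficient function of one cell as a matrix on the ring. -/
def onCell (h : n * p = N) (x : Fin n) : ((Fin p → α) × (Fin p → α) → ℂ) →ₗ[ℂ] ChainOp α N where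
  toFun a := of fun i j => a (pairCells h (i, j) x)
  map_add' _ _ := rfl
  map_smul' _ _ := rfl

theorem onCell_apply (h : n * p = N) (x : Fin n) (a : (Fin p → α) × (Fin p → α) → ℂ)
    (i j : Fin N → α) : onCell h x a i j = a (pairCells h (i, j) x) := rfl

theorem onCell_hadamard_onCells (h : n * p = N) {x : Fin n}
    {c : Fin n → (Fin p → α) × (Fin p → α) → ℂ} (hc : c x = 1)
    (a : (Fin p → α) × (Fin p → α) → ℂ) :
    onCell h x a ⊙ onCells h c = onCells h (Function.update c x a) := by
  ext i j
  rw [hadamard_apply, onCell_apply, onCells, onCells, of_apply, of_apply,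
    ← Finset.mul_prod_erase _ _ (Finset.mem_univ x),
    ← Finset.mul_prod_erase _ _ (Finset.mem_univ x), hc, Pi.one_apply, one_mul,
    Function.update_self]
  refine congrArg _ (Finset.prod_congr rfl fun y hy => ?_)
  rw [Function.update_of_ne (Finset.ne_of_mem_erase hy)]

theorem onCells_traceCoeff [DecidableEq α] (h : n * p = N) (i j : Fin N → α) :
    onCells h (fun _ => traceCoeff (Fin p → α)) i j = traceCoeff (Fin N → α) (i, j) := by
  by_cases hij : i = j
  · simp [hij, onCells, traceCoeff, pairCells_apply]
  · obtain ⟨x, hx⟩ := Function.ne_iff.1 ((cells h).injective.ne hij)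
    exact (Finset.prod_eq_zero (Finset.mem_univ x) (if_neg hx)).trans (if_neg hij).symm

variable [Fintype α]

theorem pairing_onCells_ringOp (h : n * p = N) (A : LocalTensor (Fin p → α) χ)
    (a : Fin n → (Fin p → α) × (Fin p → α) → ℂ) :
    pairing (onCells h a) (ringOp h A) = (List.ofFn fun x => contract A (a x)).prod.trace := by
  simp only [prod_ofFn_contract, trace_sum, trace_smul]
  exact (pairCells h).sum_comp fun w => (∏ x, a x (w x)) * (wordProd A (List.ofFn w)).trace

theorem contract_blockTensor (A : LocalTensor (Fin p → α) χ)
    (a : Fin k → (Fin p → α) × (Fin p → α) → ℂ) :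
    contract (blockTensor k A) (fun s => onCells rfl a s.1 s.2) =
      (List.ofFn fun y => contract A (a y)).prod := by
  rw [prod_ofFn_contract]
  exact (pairCells rfl).sum_comp fun w => (∏ y, a y (w y)) • wordProd A (List.ofFn w)

theorem transferMatrix_blockTensor (A : LocalTensor (Fin p → α) χ) :
    transferMatrix (blockTensor k A) = transferMatrix A ^ k := by
  classical
  have traceCoeff_eq : traceCoeff (Fin (k * p) → α) =
      fun s => onCells rfl (fun _ : Fin k => traceCoeff (Fin p → α)) s.1 s.2 :=
    funext fun s => (onCells_traceCoeff rfl s.1 s.2).symm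
  rw [← contract_traceCoeff, traceCoeff_eq, contract_blockTensor, List.ofFn_const,
    List.prod_replicate, contract_traceCoeff]

theorem trace_ringOp (h : n * p = N) (A : LocalTensor (Fin p → α) χ) :
    (ringOp h A).trace = (transferMatrix A ^ n).trace := by
  classical
  have one_eq : (1 : ChainOp α N) = onCells h fun _ => traceCoeff (Fin p → α) := by
    ext i j
    rw [onCells_traceCoeff, one_apply, traceCoeff]
  rw [← pairing_one_left, one_eq, pairing_onCells_ringOp, List.ofFn_const, List.prod_replicate,
    contract_traceCoeff]

end ProductFunctionals

section Locality

/-- The matrix entries depend only on the configurations on the sites of `b`. -/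
def LocalOn (b : Set (Fin N)) (f : ChainOp α N) : Prop :=
  ∀ ⦃i i' j j'⦄, Set.EqOn i i' b → Set.EqOn j j' b → f i j = f i' j'

theorem LocalOn.mono {b b' : Set (Fin N)} {f : ChainOp α N} (hf : LocalOn b f) (hb : b ⊆ b') :
    LocalOn b' f :=
  fun _ _ _ _ hi hj => hf (hi.mono hb) (hj.mono hb)

theorem LocalOn.hadamard {b : Set (Fin N)} {f g : ChainOp α N} (hf : LocalOn b f)
    (hg : LocalOn b g) : LocalOn b (f ⊙ g) :=
  fun _ _ _ _ hi hj => congrArg₂ (· * ·) (hf hi hj) (hg hi hj)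

theorem localOn_onCell (h : n * p = N) (x : Fin n) (a : (Fin p → α) × (Fin p → α) → ℂ) :
    LocalOn (cell N p x) (onCell h x a) := by
  intro i i' j j' hi hj
  rw [onCell_apply, onCell_apply, pairCells_apply, pairCells_apply, (cells_eq_iff h i i' x).2 hi,
    (cells_eq_iff h j j' x).2 hj]

theorem localOn_onCells (h : n * p = N) {a : Fin n → (Fin p → α) × (Fin p → α) → ℂ}
    {b : Set (Fin N)} (ha : ∀ x, a x ≠ 1 → cell N p x ⊆ b) : LocalOn b (onCells h a) := by
  intro i i' j j' hi hj
  rw [onCells, of_apply, of_apply]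
  refine Finset.prod_congr rfl fun x _ => ?_
  by_cases hx : a x = 1
  · rw [hx, Pi.one_apply, Pi.one_apply]
  · exact (localOn_onCell h x (a x)).mono (ha x hx) hi hj

/-- The coefficient function of an operator that is local on one cell. -/
def cellCoeff (h : n * p = N) : ChainOp α N →ₗ[ℂ] ((Fin p → α) × (Fin p → α) → ℂ) where
  toFun f s := f ((cells h).symm fun _ => s.1) ((cells h).symm fun _ => s.2)
  map_add' _ _ := rfl
  map_smul' _ _ := rfl

theorem LocalOn.onCell_cellCoeff (h : n * p = N) {x : Fin n} {f : ChainOp α N}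
    (hf : LocalOn (cell N p x) f) : onCell h x (cellCoeff h f) = f := by
  ext i j
  refine hf ?_ ?_ <;> rw [← cells_eq_iff h, Equiv.apply_symm_apply] <;> rfl

theorem LocalOn.apply_pairCells_symm_update (h : n * p = N) {x : Fin n} {g : ChainOp α N}
    (hg : LocalOn (cell N p x)ᶜ g) (w : Fin n → (Fin p → α) × (Fin p → α))
    (s : (Fin p → α) × (Fin p → α)) :
    g ((pairCells h).symm (Function.update w x s)).1
        ((pairCells h).symm (Function.update w x s)).2 =
      g ((pairCells h).symm w).1 ((pairCells h).symm w).2 := by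
  have agree (y : Fin n) (hy : y ≠ x) : pairCells h ((pairCells h).symm (Function.update w x s)) y =
      pairCells h ((pairCells h).symm w) y := by
    rw [Equiv.apply_symm_apply, Equiv.apply_symm_apply, Function.update_of_ne hy]
  exact hg (eqOn_compl_cell h fun y hy => congrArg Prod.fst (agree y hy))
    (eqOn_compl_cell h fun y hy => congrArg Prod.snd (agree y hy))

theorem sum_smul_wordProd_update {σ : Type} [Fintype σ] (A : LocalTensor σ χ)
    (w : Fin n → σ × σ) (x : Fin n) (a : σ × σ → ℂ) :
    ∑ s, a s • wordProd A (List.ofFn (Function.update w x s)) =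
      (List.ofFn (Function.update (fun y => A (w y).1 (w y).2) x (contract A a))).prod := by
  have sum_update := (MultilinearMap.mkPiAlgebraFin ℂ n (Matrix (Fin χ) (Fin χ) ℂ)).map_update_sum
    Finset.univ x (fun s => a s • A s.1 s.2) fun y => A (w y).1 (w y).2
  simp only [MultilinearMap.map_update_smul, MultilinearMap.mkPiAlgebraFin_apply] at sum_update
  refine Eq.trans (Finset.sum_congr rfl fun s _ => ?_) sum_update.symm
  rw [wordProd_ofFn]
  congr 3
  funext y
  by_cases hy : y = x
  · subst hy; simp
  · simp [hy]

theorem sum_eq_zero_of_sum_update_eq_zero {ι β M : Type*} [Fintype ι] [DecidableEq ι] [Fintype β]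
    [AddCommMonoid M] {F : (ι → β) → M} (x : ι)
    (hF : ∀ w, ∑ s, F (Function.update w x s) = 0) : ∑ w, F w = 0 := by
  classical
  rw [← (Equiv.funSplitAt x β).symm.sum_comp, Fintype.sum_prod_type_right]
  refine Finset.sum_eq_zero fun rest _ => ?_
  rcases isEmpty_or_nonempty β with hβ | ⟨⟨s₀⟩⟩
  · simp
  · rw [← hF ((Equiv.funSplitAt x β).symm (s₀, rest))]
    refine Finset.sum_congr rfl fun s _ => congrArg F (funext fun y => ?_)
    by_cases hy : y = x
    · subst hy; simp
    · simp [hy]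

theorem pairing_onCell_hadamard_ringOp_eq_zero [Fintype α] (h : n * p = N)
    {A : LocalTensor (Fin p → α) χ} {x : Fin n} {a : (Fin p → α) × (Fin p → α) → ℂ}
    (ha : contract A a = 0) {g : ChainOp α N} (hg : LocalOn (cell N p x)ᶜ g) :
    pairing (onCell h x a ⊙ g) (ringOp h A) = 0 := by
  have sum_update (w : Fin n → (Fin p → α) × (Fin p → α)) :
      ∑ s, a s • wordProd A (List.ofFn (Function.update w x s)) = 0 := by
    rw [sum_smul_wordProd_update, ha]
    exact (MultilinearMap.mkPiAlgebraFin ℂ n (Matrix (Fin χ) (Fin χ) ℂ)).map_update_zero _ x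
  rw [pairing_apply, ← (pairCells h).symm.sum_comp]
  refine sum_eq_zero_of_sum_update_eq_zero x fun w => ?_
  have trace_eq := congrArg trace (sum_update w)
  simp only [trace_sum, trace_smul, trace_zero, smul_eq_mul] at trace_eq
  simp only [hadamard_apply, onCell_apply, hg.apply_pairCells_symm_update, ringOp, of_apply,
    Prod.mk.eta, Equiv.apply_symm_apply, Function.update_self, mul_right_comm _ (g _ _)]
  rw [← Finset.sum_mul, trace_eq, zero_mul]

end Locality

end Cells

section Transpose

variable {κ : Type} [Fintype κ]

/-- Invertible trace-preserving maps, not necessarily positive. -/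
structure IsReversible (Φ : SuperOp κ) : Prop where
  trace_eq : ∀ X, (Φ X).trace = X.trace
  bijective : Function.Bijective Φ

theorem IsReversible.exists_inverse {Φ : SuperOp κ} (hΦ : IsReversible Φ) :
    ∃ Ψ : SuperOp κ, IsReversible Ψ ∧ Ψ ∘ₗ Φ = LinearMap.id ∧ Φ ∘ₗ Ψ = LinearMap.id := by
  let e := LinearEquiv.ofBijective Φ hΦ.bijective
  have trace_symm (X : Matrix κ κ ℂ) : (e.symm X).trace = X.trace :=
    (hΦ.trace_eq _).symm.trans (congrArg trace (e.apply_symm_apply X))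
  exact ⟨e.symm.toLinearMap, ⟨trace_symm, e.symm.bijective⟩, LinearMap.ext e.symm_apply_apply,
    LinearMap.ext e.apply_symm_apply⟩

variable [DecidableEq κ]

theorem IsNondegenerateChannel.isReversible {Φ : SuperOp κ} (hΦ : IsNondegenerateChannel Φ) :
    IsReversible Φ := by
  refine ⟨fun X => ?_, hΦ.injective, LinearMap.injective_iff_surjective.1 hΦ.injective⟩
  obtain ⟨m, K, hK, hΦK⟩ := hΦ.channel
  calc (Φ X).trace = ∑ a, ((K a)ᴴ * K a * X).trace := by
        rw [hΦK, trace_sum]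
        exact Finset.sum_congr rfl fun a _ => trace_mul_cycle _ _ _
    _ = X.trace := by rw [← trace_sum, ← Finset.sum_mul, hK, one_mul]

/-- The transpose of a superoperator with respect to the bilinear pairing. -/
def transposeOp (Φ : SuperOp κ) : SuperOp κ where
  toFun f := of fun a b => pairing f (Φ (single a b 1))
  map_add' f g := by ext a b; simp
  map_smul' c f := by ext a b; simp

theorem pairing_transposeOp (Φ : SuperOp κ) (f X : Matrix κ κ ℂ) :
    pairing (transposeOp Φ f) X = pairing f (Φ X) := by
  have : pairing (transposeOp Φ f) = pairing f ∘ₗ Φ :=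
    ext_linearMap ℂ fun a b => LinearMap.ext_ring (pairing_single_right _ a b)
  exact LinearMap.congr_fun this X

theorem transposeOp_transposeOp {Φ Ψ : SuperOp κ} (h : Ψ ∘ₗ Φ = LinearMap.id)
    (f : Matrix κ κ ℂ) : transposeOp Φ (transposeOp Ψ f) = f := by
  refine pairing_injective (LinearMap.ext fun X => ?_)
  rw [pairing_transposeOp, pairing_transposeOp, ← LinearMap.comp_apply Ψ Φ, h, LinearMap.id_apply]

theorem IsReversible.transposeOp_one {Φ : SuperOp κ} (hΦ : IsReversible Φ) :
    transposeOp Φ 1 = 1 := by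
  refine pairing_injective (LinearMap.ext fun X => ?_)
  rw [pairing_transposeOp, pairing_one_left, pairing_one_left, hΦ.trace_eq]

end Transpose

section Gates

variable {d N : ℕ} {x y : Fin N}

theorem setPair_left (hxy : x ≠ y) (i : Fin N → Fin d) (a : Fin d × Fin d) :
    setPair i x y a x = a.1 := by simp [setPair, hxy]

theorem setPair_right (i : Fin N → Fin d) (a : Fin d × Fin d) : setPair i x y a y = a.2 := by
  simp [setPair]

theorem setPair_of_ne {s : Fin N} (hx : s ≠ x) (hy : s ≠ y) (i : Fin N → Fin d)
    (a : Fin d × Fin d) : setPair i x y a s = i s := by simp [setPair, hx, hy]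

theorem setPair_setPair (hxy : x ≠ y) (i : Fin N → Fin d) (a b : Fin d × Fin d) :
    setPair (setPair i x y a) x y b = setPair i x y b := by
  rw [setPair, setPair, setPair, Function.update_comm hxy, Function.update_idem,
    Function.update_comm hxy.symm, Function.update_idem]

theorem setPair_self (i : Fin N → Fin d) : setPair i x y (i x, i y) = i := by
  simp [setPair]

theorem setPair_eqOn {b : Set (Fin N)} (hx : x ∉ b) (hy : y ∉ b) (i : Fin N → Fin d)
    (a : Fin d × Fin d) : Set.EqOn (setPair i x y a) i b :=
  fun _ hs => setPair_of_ne (ne_of_mem_of_not_mem hs hx) (ne_of_mem_of_not_mem hs hy) i a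

theorem setPair_congr {b : Set (Fin N)} {i i' : Fin N → Fin d} (h : Set.EqOn i i' b)
    (a : Fin d × Fin d) : Set.EqOn (setPair i x y a) (setPair i' x y a) b := by
  intro s hs
  simp only [setPair, Function.update_apply, h hs]

/-- The two-site operator obtained from an operator on the ring by fixing the configurations of
all sites other than `x` and `y`. -/
def pairSlice (x y : Fin N) (i j : Fin N → Fin d) (X : ChainOp (Fin d) N) :
    Matrix (Fin d × Fin d) (Fin d × Fin d) ℂ :=
  of fun a b => X (setPair i x y a) (setPair j x y b)

theorem onSites_apply (Φ : SuperOp (Fin d × Fin d)) (X : ChainOp (Fin d) N)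
    (i j : Fin N → Fin d) :
    onSites Φ x y X i j = Φ (pairSlice x y i j X) (i x, i y) (j x, j y) := rfl

theorem pairSlice_onSites (Φ : SuperOp (Fin d × Fin d)) (hxy : x ≠ y) (i j : Fin N → Fin d)
    (X : ChainOp (Fin d) N) :
    pairSlice x y i j (onSites Φ x y X) = Φ (pairSlice x y i j X) := by
  ext a b
  simp only [pairSlice, of_apply, onSites_apply, setPair_setPair hxy, setPair_left hxy,
    setPair_right]

theorem onSites_onSites (Φ Ψ : SuperOp (Fin d × Fin d)) (hxy : x ≠ y) (X : ChainOp (Fin d) N) :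
    onSites Φ x y (onSites Ψ x y X) = onSites (Φ ∘ₗ Ψ) x y X := by
  ext i j
  rw [onSites_apply, pairSlice_onSites Ψ hxy]
  rfl

theorem onSites_id (X : ChainOp (Fin d) N) : onSites LinearMap.id x y X = X := by
  ext i j
  rw [onSites_apply, LinearMap.id_apply, pairSlice, of_apply, setPair_self, setPair_self]

/-- Exchanging the entries at two sites of a configuration with a given pair. -/
def swapPair (hxy : x ≠ y) : Equiv.Perm ((Fin N → Fin d) × (Fin d × Fin d)) :=
  Function.Involutive.toPerm (fun z => (setPair z.1 x y z.2, (z.1 x, z.1 y))) fun z => by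
    simp only [setPair_setPair hxy, setPair_self, setPair_left hxy, setPair_right]

theorem sum_setPair {M : Type*} [AddCommMonoid M] (hxy : x ≠ y) (F : (Fin N → Fin d) → M) :
    ∑ i, ∑ a, F (setPair i x y a) = (d * d) • ∑ i, F i := by
  calc ∑ i, ∑ a, F (setPair i x y a) = ∑ z, F (swapPair hxy z).1 :=
        (Fintype.sum_prod_type fun z => F (swapPair hxy z).1).symm
    _ = ∑ z : (Fin N → Fin d) × (Fin d × Fin d), F z.1 :=
        Equiv.sum_comp (swapPair hxy) fun z => F z.1
    _ = (d * d) • ∑ i, F i := by simp [Fintype.sum_prod_type, Finset.smul_sum]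

theorem sum_pairing_pairSlice (hxy : x ≠ y) (f X : ChainOp (Fin d) N) :
    ∑ i, ∑ j, pairing (pairSlice x y i j f) (pairSlice x y i j X) =
      (d * d) • (d * d) • pairing f X := by
  let F (i j : Fin N → Fin d) : ℂ := f i j * X i j
  calc ∑ i, ∑ j, pairing (pairSlice x y i j f) (pairSlice x y i j X)
      = ∑ i, ∑ j, ∑ a, ∑ b, F (setPair i x y a) (setPair j x y b) :=
        Finset.sum_congr rfl fun i _ => Finset.sum_congr rfl fun j _ =>
          Fintype.sum_prod_type _
    _ = ∑ i, ∑ a, ∑ j, ∑ b, F (setPair i x y a) (setPair j x y b) :=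
        Finset.sum_congr rfl fun i _ => Finset.sum_comm
    _ = (d * d) • (d * d) • pairing f X := by
        simp only [sum_setPair hxy, ← Finset.smul_sum]
        rw [sum_setPair hxy fun i => ∑ j, F i j, pairing_apply, Fintype.sum_prod_type]

theorem pairing_onSites (Φ : SuperOp (Fin d × Fin d)) (hxy : x ≠ y) (f X : ChainOp (Fin d) N) :
    pairing f (onSites Φ x y X) = pairing (onSites (transposeOp Φ) x y f) X := by
  rcases eq_or_ne d 0 with rfl | hd
  · have : IsEmpty (Fin N → Fin 0) := ⟨fun i => (i x).elim0⟩
    exact Fintype.sum_empty _ |>.trans (Fintype.sum_empty _).symm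
  · have hdd := mul_ne_zero hd hd
    refine smul_right_injective ℂ hdd (smul_right_injective ℂ hdd ?_)
    simp only [← sum_pairing_pairSlice hxy, pairSlice_onSites _ hxy, pairing_transposeOp]

theorem LocalOn.onSites {b : Set (Fin N)} {f : ChainOp (Fin d) N} (hf : LocalOn b f)
    (Φ : SuperOp (Fin d × Fin d)) (hx : x ∈ b) (hy : y ∈ b) : LocalOn b (onSites Φ x y f) := by
  intro i i' j j' hi hj
  have slice_eq : pairSlice x y i j f = pairSlice x y i' j' f :=
    Matrix.ext fun a c => hf (setPair_congr hi a) (setPair_congr hj c)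
  rw [onSites_apply, onSites_apply, slice_eq, hi hx, hi hy, hj hx, hj hy]

theorem onSites_hadamard (Φ : SuperOp (Fin d × Fin d)) {b : Set (Fin N)} (hx : x ∉ b)
    (hy : y ∉ b) (f : ChainOp (Fin d) N) {g : ChainOp (Fin d) N} (hg : LocalOn b g) :
    onSites Φ x y (f ⊙ g) = onSites Φ x y f ⊙ g := by
  ext i j
  have slice_eq : pairSlice x y i j (f ⊙ g) = g i j • pairSlice x y i j f := by
    ext a c
    rw [Matrix.smul_apply, smul_eq_mul, mul_comm,
      ← hg (setPair_eqOn hx hy i a) (setPair_eqOn hx hy j c)]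
    rfl
  rw [onSites_apply, slice_eq, map_smul, Matrix.smul_apply, smul_eq_mul, mul_comm]
  rfl

open Classical in
/-- The functional that traces out the sites of `S`. -/
noncomputable def traceOut (S : Set (Fin N)) : ChainOp (Fin d) N :=
  of fun i j => if Set.EqOn i j S then 1 else 0

theorem localOn_traceOut (S : Set (Fin N)) : LocalOn S (traceOut S : ChainOp (Fin d) N) := by
  classical
  intro i i' j j' hi hj
  have : Set.EqOn i j S ↔ Set.EqOn i' j' S :=
    ⟨fun h => hi.symm.trans (h.trans hj), fun h => hi.trans (h.trans hj.symm)⟩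
  exact if_congr this rfl rfl

theorem traceOut_union (S T : Set (Fin N)) :
    (traceOut (S ∪ T) : ChainOp (Fin d) N) = traceOut S ⊙ traceOut T := by
  classical
  ext i j
  refine (if_congr Set.eqOn_union rfl rfl).trans ?_
  rw [hadamard_apply, traceOut, traceOut, of_apply, of_apply, ite_and, ite_mul, one_mul, zero_mul]

theorem onSites_traceOut_pair {Φ : SuperOp (Fin d × Fin d)} (hΦ : IsReversible Φ) (hxy : x ≠ y) :
    onSites (transposeOp Φ) x y (traceOut {x, y}) = traceOut {x, y} := by
  classical
  have traceOut_pair (i j : Fin N → Fin d) :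
      traceOut {x, y} i j = if i x = j x ∧ i y = j y then 1 else 0 :=
    if_congr (by simp [Set.EqOn]) rfl rfl
  ext i j
  have slice_eq : pairSlice x y i j (traceOut {x, y}) = 1 := by
    ext a b
    simp only [pairSlice, of_apply, traceOut_pair, setPair_left hxy, setPair_right, one_apply,
      Prod.ext_iff]
  simp only [onSites_apply, slice_eq, hΦ.transposeOp_one, traceOut_pair, one_apply, Prod.ext_iff]

theorem onSites_traceOut {Φ : SuperOp (Fin d × Fin d)} (hΦ : IsReversible Φ) (hxy : x ≠ y)
    {S : Set (Fin N)} (hx : x ∈ S) (hy : y ∈ S) :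
    onSites (transposeOp Φ) x y (traceOut S) = traceOut S := by
  rw [← Set.union_sdiff_cancel (Set.pair_subset hx hy), traceOut_union,
    onSites_hadamard _ (by simp) (by simp) _ (localOn_traceOut _), onSites_traceOut_pair hΦ hxy]

end Gates

section LocalProperties

variable {d N : ℕ} {b₁ b₂ c₁ c₂ S T : Set (Fin N)} {x y : Fin N} {Φ : SuperOp (Fin d × Fin d)}
  {X : ChainOp (Fin d) N}

/-- A symmetric property of an operator and two disjoint regions that passes to smaller regions
and is preserved by reversible gates acting within a region or outside both of them. -/
structure IsLocalProperty (P : Set (Fin N) → Set (Fin N) → ChainOp (Fin d) N → Prop) : Prop where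
  symm : ∀ {b₁ b₂ X}, P b₁ b₂ X → P b₂ b₁ X
  mono : ∀ {b₁ b₂ c₁ c₂ X}, Disjoint b₁ b₂ → c₁ ⊆ b₁ → c₂ ⊆ b₂ → P b₁ b₂ X → P c₁ c₂ X
  gate_inside : ∀ {b₁ b₂ X Φ x y}, IsReversible Φ → x ≠ y → Disjoint b₁ b₂ → x ∈ b₁ → y ∈ b₁ →
    P b₁ b₂ X → P b₁ b₂ (onSites Φ x y X)
  gate_outside : ∀ {b₁ b₂ X Φ x y}, IsReversible Φ → x ≠ y → x ∉ b₁ ∪ b₂ → y ∉ b₁ ∪ b₂ →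
    P b₁ b₂ X → P b₁ b₂ (onSites Φ x y X)

theorem IsLocalProperty.gate {P : Set (Fin N) → Set (Fin N) → ChainOp (Fin d) N → Prop}
    (hP : IsLocalProperty P) (hΦ : IsReversible Φ) (hxy : x ≠ y) (hb : Disjoint b₁ b₂)
    (h₁ : x ∈ b₁ ↔ y ∈ b₁) (h₂ : x ∈ b₂ ↔ y ∈ b₂) (hX : P b₁ b₂ X) :
    P b₁ b₂ (onSites Φ x y X) := by
  by_cases hx₁ : x ∈ b₁
  · exact hP.gate_inside hΦ hxy hb hx₁ (h₁.1 hx₁) hX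
  by_cases hx₂ : x ∈ b₂
  · exact hP.symm (hP.gate_inside hΦ hxy hb.symm hx₂ (h₂.1 hx₂) (hP.symm hX))
  have hx : x ∉ b₁ ∪ b₂ := not_or.2 ⟨hx₁, hx₂⟩
  exact hP.gate_outside hΦ hxy hx (by rwa [Set.mem_union, ← h₁, ← h₂]) hX

theorem pairing_hadamard_onSites_left (Φ : SuperOp (Fin d × Fin d)) (hxy : x ≠ y) (hx : x ∉ S)
    (hy : y ∉ S) (f : ChainOp (Fin d) N) {g : ChainOp (Fin d) N} (hg : LocalOn S g)
    (X : ChainOp (Fin d) N) :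
    pairing (f ⊙ g) (onSites Φ x y X) = pairing (onSites (transposeOp Φ) x y f ⊙ g) X := by
  rw [pairing_onSites Φ hxy, onSites_hadamard _ hx hy _ hg]

theorem pairing_hadamard_onSites_right (Φ : SuperOp (Fin d × Fin d)) (hxy : x ≠ y) (hx : x ∉ S)
    (hy : y ∉ S) {f : ChainOp (Fin d) N} (hf : LocalOn S f) (g X : ChainOp (Fin d) N) :
    pairing (f ⊙ g) (onSites Φ x y X) = pairing (f ⊙ onSites (transposeOp Φ) x y g) X := by
  rw [hadamard_comm, pairing_hadamard_onSites_left Φ hxy hx hy g hf, hadamard_comm]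

theorem LocalOn.exists_eq_sum_hadamard {f : ChainOp (Fin d) N} (hf : LocalOn (S ∪ T) f) :
    ∃ (κ : Type) (_ : Fintype κ) (g h : κ → ChainOp (Fin d) N),
      (∀ k, LocalOn S (g k)) ∧ (∀ k, LocalOn T (h k)) ∧ f = ∑ k, g k ⊙ h k := by
  classical
  let glue (p : S → Fin d) (i : Fin N → Fin d) (s : Fin N) : Fin d :=
    if hs : s ∈ S then p ⟨s, hs⟩ else i s
  have glue_restrict (i : Fin N → Fin d) : glue (S.domRestrict i) i = i := by
    funext s
    simp [glue]
  have glue_eqOn (p : S → Fin d) {i i' : Fin N → Fin d} (hi : Set.EqOn i i' T) :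
      Set.EqOn (glue p i) (glue p i') (S ∪ T) := by
    intro s hs
    by_cases hsS : s ∈ S
    · simp [glue, hsS]
    · simp [glue, hsS, hi (hs.resolve_left hsS)]
  refine ⟨(S → Fin d) × (S → Fin d), inferInstance,
    fun k => of fun i j => if (S.domRestrict i, S.domRestrict j) = k then 1 else 0,
    fun k => of fun i j => f (glue k.1 i) (glue k.2 j), fun k i i' j j' hi hj => ?_,
    fun k i i' j j' hi hj => hf (glue_eqOn _ hi) (glue_eqOn _ hj), ?_⟩
  · have hi' : S.domRestrict i = S.domRestrict i' := Set.domRestrict_eq_domRestrict_iff.2 hi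
    have hj' : S.domRestrict j = S.domRestrict j' := Set.domRestrict_eq_domRestrict_iff.2 hj
    simp only [of_apply, hi', hj']
  · ext i j
    simp [Matrix.sum_apply, glue_restrict]

/-- Two regions are independent: if a product of functionals on them annihilates the operator
whatever is measured on the other sites, then so does one of its factors. -/
def Independent (b₁ b₂ : Set (Fin N)) (X : ChainOp (Fin d) N) : Prop :=
  ∀ f₁ f₂, LocalOn b₁ f₁ → LocalOn b₂ f₂ →
    (∀ g, LocalOn (b₁ ∪ b₂)ᶜ g → pairing (f₁ ⊙ (f₂ ⊙ g)) X = 0) →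
      (∀ g, LocalOn b₁ᶜ g → pairing (f₁ ⊙ g) X = 0) ∨
        ∀ g, LocalOn b₂ᶜ g → pairing (f₂ ⊙ g) X = 0

theorem hadamard_left_swap (f g h : ChainOp (Fin d) N) : f ⊙ (g ⊙ h) = g ⊙ (f ⊙ h) := by
  rw [← hadamard_assoc, hadamard_comm f g, hadamard_assoc]

theorem Independent.symm (h : Independent b₁ b₂ X) : Independent b₂ b₁ X := by
  refine fun f₂ f₁ hf₂ hf₁ hX => (h f₁ f₂ hf₁ hf₂ fun g hg => ?_).symm
  rw [hadamard_left_swap]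
  exact hX g (by rwa [Set.union_comm])

theorem exists_localOn_pairing_ne_zero (b : Set (Fin N)) {c : Set (Fin N)} {f : ChainOp (Fin d) N}
    (h : ¬ ∀ g, LocalOn cᶜ g → pairing (f ⊙ g) X = 0) :
    ∃ φ, LocalOn (b \ c) φ ∧ ¬ ∀ g, LocalOn bᶜ g → pairing ((f ⊙ φ) ⊙ g) X = 0 := by
  contrapose! h
  intro g hg
  obtain ⟨κ, _, φ, w, hφ, hw, rfl⟩ := LocalOn.exists_eq_sum_hadamard
    (S := b \ c) (T := bᶜ) (hg.mono fun s hs => (em (s ∈ b)).imp (⟨·, hs⟩) id)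
  have distrib : f ⊙ ∑ k, φ k ⊙ w k = ∑ k, (f ⊙ φ k) ⊙ w k := by
    ext i j
    simp [Matrix.sum_apply, Finset.mul_sum, mul_assoc]
  rw [distrib, map_sum, LinearMap.sum_apply]
  exact Finset.sum_eq_zero fun k _ => h _ (hφ k) _ (hw k)

theorem Independent.mono (hb : Disjoint b₁ b₂) (h₁ : c₁ ⊆ b₁) (h₂ : c₂ ⊆ b₂)
    (h : Independent b₁ b₂ X) : Independent c₁ c₂ X := by
  intro f₁ f₂ hf₁ hf₂ hX
  by_contra hne
  obtain ⟨hne₁, hne₂⟩ := not_or.1 hne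
  obtain ⟨φ₁, hφ₁, hX₁⟩ := exists_localOn_pairing_ne_zero b₁ hne₁
  obtain ⟨φ₂, hφ₂, hX₂⟩ := exists_localOn_pairing_ne_zero b₂ hne₂
  refine (h (f₁ ⊙ φ₁) (f₂ ⊙ φ₂) ((hf₁.mono h₁).hadamard (hφ₁.mono Set.sdiff_subset))
    ((hf₂.mono h₂).hadamard (hφ₂.mono Set.sdiff_subset)) fun g hg => ?_).elim hX₁ hX₂
  have regroup : (f₁ ⊙ φ₁) ⊙ ((f₂ ⊙ φ₂) ⊙ g) = f₁ ⊙ (f₂ ⊙ (φ₁ ⊙ (φ₂ ⊙ g))) := by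
    ext i j
    simp only [hadamard_apply]
    ring
  rw [regroup]
  refine hX _ ((hφ₁.mono ?_).hadamard ((hφ₂.mono ?_).hadamard
    (hg.mono (Set.compl_subset_compl.2 (Set.union_subset_union h₁ h₂)))))
  · exact fun s hs => not_or.2 ⟨hs.2, fun hc => Set.disjoint_left.1 hb hs.1 (h₂ hc)⟩
  · exact fun s hs => not_or.2 ⟨fun hc => Set.disjoint_left.1 hb (h₁ hc) hs.1, hs.2⟩

theorem Independent.onSites_of_mem (Φ : SuperOp (Fin d × Fin d)) (hxy : x ≠ y)
    (hb : Disjoint b₁ b₂) (hx : x ∈ b₁) (hy : y ∈ b₁) (h : Independent b₁ b₂ X) :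
    Independent b₁ b₂ (onSites Φ x y X) := by
  intro f₁ f₂ hf₁ hf₂ hX
  have hx' : x ∉ b₁ᶜ := not_not.2 hx
  have hy' : y ∉ b₁ᶜ := not_not.2 hy
  have hx₂ : x ∉ b₂ := Set.disjoint_left.1 hb hx
  have hy₂ : y ∉ b₂ := Set.disjoint_left.1 hb hy
  refine (h (onSites (transposeOp Φ) x y f₁) f₂ (hf₁.onSites _ hx hy) hf₂ fun g hg => ?_).imp
    (fun h₁ g hg => ?_) fun h₂ g hg => ?_
  · rw [← pairing_hadamard_onSites_left Φ hxy hx' hy' f₁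
      ((hf₂.mono (Set.subset_compl_iff_disjoint_left.2 hb)).hadamard
        (hg.mono (Set.compl_subset_compl.2 Set.subset_union_left)))]
    exact hX g hg
  · rw [pairing_hadamard_onSites_left Φ hxy hx' hy' _ hg]
    exact h₁ g hg
  · rw [pairing_hadamard_onSites_right Φ hxy hx₂ hy₂ hf₂]
    exact h₂ _ (hg.onSites _ hx₂ hy₂)

theorem onSites_transposeOp_cancel {Ψ : SuperOp (Fin d × Fin d)} (hxy : x ≠ y)
    (h : Ψ ∘ₗ Φ = LinearMap.id) (g : ChainOp (Fin d) N) :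
    onSites (transposeOp Φ) x y (onSites (transposeOp Ψ) x y g) = g := by
  have comp_eq : transposeOp Φ ∘ₗ transposeOp Ψ = LinearMap.id :=
    LinearMap.ext fun f => transposeOp_transposeOp h f
  rw [onSites_onSites _ _ hxy, comp_eq, onSites_id]

theorem Independent.onSites_of_notMem (hΦ : IsReversible Φ) (hxy : x ≠ y) (hx : x ∉ b₁ ∪ b₂)
    (hy : y ∉ b₁ ∪ b₂) (h : Independent b₁ b₂ X) : Independent b₁ b₂ (onSites Φ x y X) := by
  obtain ⟨hx₁, hx₂⟩ := not_or.1 hx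
  obtain ⟨hy₁, hy₂⟩ := not_or.1 hy
  intro f₁ f₂ hf₁ hf₂ hX
  obtain ⟨Ψ, -, hΨ, -⟩ := hΦ.exists_inverse
  refine (h f₁ f₂ hf₁ hf₂ fun g hg => ?_).imp (fun h₁ g hg => ?_) fun h₂ g hg => ?_
  · have hf : LocalOn (b₁ ∪ b₂) (f₁ ⊙ f₂) :=
      (hf₁.mono Set.subset_union_left).hadamard (hf₂.mono Set.subset_union_right)
    rw [← hadamard_assoc, ← onSites_transposeOp_cancel hxy hΨ g,
      ← pairing_hadamard_onSites_right Φ hxy hx hy hf, hadamard_assoc]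
    exact hX _ (hg.onSites _ hx hy)
  · rw [pairing_hadamard_onSites_right Φ hxy hx₁ hy₁ hf₁]
    exact h₁ _ (hg.onSites _ hx₁ hy₁)
  · rw [pairing_hadamard_onSites_right Φ hxy hx₂ hy₂ hf₂]
    exact h₂ _ (hg.onSites _ hx₂ hy₂)

theorem isLocalProperty_independent : IsLocalProperty (Independent (d := d) (N := N)) where
  symm h := h.symm
  mono hb h₁ h₂ h := h.mono hb h₁ h₂
  gate_inside _ hxy hb hx hy h := h.onSites_of_mem _ hxy hb hx hy
  gate_outside hΦ hxy hx hy h := h.onSites_of_notMem hΦ hxy hx hy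

/-- The operator Schmidt rank between two regions, with all other sites traced out, is at most the
cardinality of `κ`. -/
def SchmidtRankLE (κ : Type) [Fintype κ] (b₁ b₂ : Set (Fin N)) (X : ChainOp (Fin d) N) : Prop :=
  ∃ α β : κ → Dual ℂ (ChainOp (Fin d) N), ∀ f₁ f₂, LocalOn b₁ f₁ → LocalOn b₂ f₂ →
    pairing (f₁ ⊙ (f₂ ⊙ traceOut (b₁ ∪ b₂)ᶜ)) X = ∑ k, α k f₁ * β k f₂

variable {κ : Type} [Fintype κ]

theorem SchmidtRankLE.symm (h : SchmidtRankLE κ b₁ b₂ X) : SchmidtRankLE κ b₂ b₁ X := by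
  obtain ⟨α, β, hαβ⟩ := h
  refine ⟨β, α, fun f₂ f₁ hf₂ hf₁ => ?_⟩
  rw [hadamard_left_swap, Set.union_comm, hαβ f₁ f₂ hf₁ hf₂]
  exact Finset.sum_congr rfl fun k _ => mul_comm _ _

/-- Entrywise multiplication by a fixed operator. -/
def hadamardRight (g : ChainOp (Fin d) N) : ChainOp (Fin d) N →ₗ[ℂ] ChainOp (Fin d) N where
  toFun f := f ⊙ g
  map_add' f f' := add_hadamard g f f'
  map_smul' c f := smul_hadamard f g c

theorem SchmidtRankLE.mono (hb : Disjoint b₁ b₂) (h₁ : c₁ ⊆ b₁) (h₂ : c₂ ⊆ b₂)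
    (h : SchmidtRankLE κ b₁ b₂ X) : SchmidtRankLE κ c₁ c₂ X := by
  obtain ⟨α, β, hαβ⟩ := h
  refine ⟨fun k => α k ∘ₗ hadamardRight (traceOut (b₁ \ c₁)),
    fun k => β k ∘ₗ hadamardRight (traceOut (b₂ \ c₂)), fun f₁ f₂ hf₁ hf₂ => ?_⟩
  refine Eq.trans ?_ (hαβ (f₁ ⊙ traceOut (b₁ \ c₁)) (f₂ ⊙ traceOut (b₂ \ c₂))
    ((hf₁.mono h₁).hadamard ((localOn_traceOut _).mono Set.sdiff_subset))
    ((hf₂.mono h₂).hadamard ((localOn_traceOut _).mono Set.sdiff_subset)))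
  have compl_eq : (c₁ ∪ c₂)ᶜ = (b₁ \ c₁) ∪ ((b₂ \ c₂) ∪ (b₁ ∪ b₂)ᶜ) := by
    ext s
    have hs : s ∈ b₁ → s ∉ b₂ := fun h => Set.disjoint_left.1 hb h
    have hs₁ := @h₁ s
    have hs₂ := @h₂ s
    simp only [Set.mem_compl_iff, Set.mem_union, Set.mem_sdiff]
    tauto
  rw [compl_eq, traceOut_union, traceOut_union]
  congr 2
  ext i j
  simp only [hadamard_apply]
  ring

theorem SchmidtRankLE.onSites_of_mem (Φ : SuperOp (Fin d × Fin d)) (hxy : x ≠ y)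
    (hb : Disjoint b₁ b₂) (hx : x ∈ b₁) (hy : y ∈ b₁) (h : SchmidtRankLE κ b₁ b₂ X) :
    SchmidtRankLE κ b₁ b₂ (onSites Φ x y X) := by
  obtain ⟨α, β, hαβ⟩ := h
  refine ⟨fun k => α k ∘ₗ onSites (transposeOp Φ) x y, β, fun f₁ f₂ hf₁ hf₂ => ?_⟩
  rw [pairing_hadamard_onSites_left Φ hxy (S := b₁ᶜ) (not_not.2 hx) (not_not.2 hy) f₁
    ((hf₂.mono (Set.subset_compl_iff_disjoint_left.2 hb)).hadamard
      ((localOn_traceOut _).mono (Set.compl_subset_compl.2 Set.subset_union_left))),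
    hαβ _ _ (hf₁.onSites _ hx hy) hf₂]
  rfl

theorem SchmidtRankLE.onSites_of_notMem (hΦ : IsReversible Φ) (hxy : x ≠ y) (hx : x ∉ b₁ ∪ b₂)
    (hy : y ∉ b₁ ∪ b₂) (h : SchmidtRankLE κ b₁ b₂ X) :
    SchmidtRankLE κ b₁ b₂ (onSites Φ x y X) := by
  obtain ⟨α, β, hαβ⟩ := h
  refine ⟨α, β, fun f₁ f₂ hf₁ hf₂ => ?_⟩
  rw [← hαβ f₁ f₂ hf₁ hf₂, ← hadamard_assoc,
    pairing_hadamard_onSites_right Φ hxy hx hy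
      ((hf₁.mono Set.subset_union_left).hadamard (hf₂.mono Set.subset_union_right)),
    onSites_traceOut hΦ hxy hx hy]

theorem isLocalProperty_schmidtRankLE (κ : Type) [Fintype κ] :
    IsLocalProperty (SchmidtRankLE (d := d) (N := N) κ) where
  symm h := h.symm
  mono hb h₁ h₂ h := h.mono hb h₁ h₂
  gate_inside _ hxy hb hx hy h := h.onSites_of_mem _ hxy hb hx hy
  gate_outside hΦ hxy hx hy h := h.onSites_of_notMem hΦ hxy hx hy

end LocalProperties

section Circuits

variable {d N : ℕ}

theorem pairing_traceOut_univ (X : ChainOp (Fin d) N) :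
    pairing (traceOut Set.univ) X = X.trace := by
  classical
  have traceOut_eq : (traceOut Set.univ : ChainOp (Fin d) N) = 1 := by
    ext i j
    simp [traceOut, one_apply]
  rw [traceOut_eq, pairing_one_left]

theorem IsReversible.trace_onSites {Φ : SuperOp (Fin d × Fin d)} (hΦ : IsReversible Φ)
    {x y : Fin N} (hxy : x ≠ y) (X : ChainOp (Fin d) N) : (onSites Φ x y X).trace = X.trace := by
  rw [← pairing_traceOut_univ, pairing_onSites Φ hxy,
    onSites_traceOut hΦ hxy (Set.mem_univ x) (Set.mem_univ y), pairing_traceOut_univ]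

theorem gateLeft_val {s : ℕ} (k : Fin (N / 2)) : (gateLeft s k).1 = 2 * k + s % 2 := rfl

theorem gateRight_val {s : ℕ} (k : Fin (N / 2)) :
    (gateRight s k).1 = if 2 * k + s % 2 + 1 = N then 0 else 2 * k + s % 2 + 1 := by
  have hk := k.2
  split_ifs with h
  · simp only [gateRight, h, Nat.mod_self]
  · exact Nat.mod_eq_of_lt (by grind)

theorem gateLeft_ne_gateRight (s : ℕ) (k : Fin (N / 2)) :
    gateLeft s k ≠ gateRight s k := by
  rw [Fin.ne_iff_vne, gateLeft_val, gateRight_val]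
  grind

theorem gateLeft_mem_arc_iff (hN : Even N) {s lo hi : ℕ} (hlo : lo % 2 = s % 2)
    (hhi : hi % 2 = s % 2) (hhiN : hi ≤ N) (k : Fin (N / 2)) :
    gateLeft s k ∈ arc N lo hi ↔ gateRight s k ∈ arc N lo hi := by
  simp only [arc, Set.mem_ofPred_eq, gateLeft_val, gateRight_val]
  grind

/-- Circuits of depth `t` all of whose gates are reversible. -/
def IsReversibleBrickwork (t : ℕ) (E : End ℂ (ChainOp (Fin d) N)) : Prop :=
  ∃ G : ℕ → Fin (N / 2) → SuperOp (Fin d × Fin d),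
    (∀ s, s < t → ∀ k, IsReversible (G s k)) ∧ E = brickwork G t

theorem IsNondegenerateBrickwork.isReversibleBrickwork {t : ℕ} {E : End ℂ (ChainOp (Fin d) N)}
    (hE : IsNondegenerateBrickwork t E) : IsReversibleBrickwork t E := by
  obtain ⟨G, hG, hEG⟩ := hE
  exact ⟨G, fun s hs k => (hG s hs k).isReversible, hEG⟩

theorem layer_induction {p : End ℂ (ChainOp (Fin d) N) → Prop} (h_one : p 1)
    (h_mul : ∀ E F, p E → p F → p (E * F)) (s : ℕ) (G : Fin (N / 2) → SuperOp (Fin d × Fin d))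
    (hG : ∀ k, p (onSites (G k) (gateLeft s k) (gateRight s k))) : p (layer s G) := by
  rw [layer]
  refine List.prod_induction p h_mul h_one fun E hE => ?_
  obtain ⟨k, rfl⟩ := List.mem_ofFn.1 hE
  exact hG k

theorem trace_layer (s : ℕ) {G : Fin (N / 2) → SuperOp (Fin d × Fin d)}
    (hG : ∀ k, IsReversible (G k)) (X : ChainOp (Fin d) N) : (layer s G X).trace = X.trace :=
  layer_induction (p := fun E => ∀ X, (E X).trace = X.trace) (fun _ => rfl)
    (fun _ _ hE hF X => (hE _).trans (hF X)) s G
    (fun k => (hG k).trace_onSites (gateLeft_ne_gateRight s k)) X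

variable {G : ℕ → Fin (N / 2) → SuperOp (Fin d × Fin d)} {t : ℕ}

theorem trace_brickwork (hG : ∀ s, s < t → ∀ k, IsReversible (G s k))
    (X : ChainOp (Fin d) N) : (brickwork G t X).trace = X.trace := by
  induction t with
  | zero => rfl
  | succ t ih =>
    exact (trace_layer t (hG t t.lt_succ_self) _).trans
      (ih fun s hs => hG s (hs.trans t.lt_succ_self))

variable {P : Set (Fin N) → Set (Fin N) → ChainOp (Fin d) N → Prop}

theorem IsLocalProperty.layer_iff (hP : IsLocalProperty P) {b₁ b₂ : Set (Fin N)}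
    (hb : Disjoint b₁ b₂) {s : ℕ} (h₁ : ∀ k, gateLeft s k ∈ b₁ ↔ gateRight s k ∈ b₁)
    (h₂ : ∀ k, gateLeft s k ∈ b₂ ↔ gateRight s k ∈ b₂)
    {G : Fin (N / 2) → SuperOp (Fin d × Fin d)} (hG : ∀ k, IsReversible (G k))
    (X : ChainOp (Fin d) N) : P b₁ b₂ (layer s G X) ↔ P b₁ b₂ X := by
  refine layer_induction (p := fun E => ∀ X, P b₁ b₂ (E X) ↔ P b₁ b₂ X) (fun _ => Iff.rfl)
    (fun _ _ hE hF X => (hE _).trans (hF X)) s G (fun k X => ⟨fun h => ?_, ?_⟩) X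
  · have hxy := gateLeft_ne_gateRight s k
    obtain ⟨Ψ, hΨ, hΨG, -⟩ := (hG k).exists_inverse
    have := hP.gate hΨ hxy hb (h₁ k) (h₂ k) h
    rwa [onSites_onSites _ _ hxy, hΨG, onSites_id] at this
  · exact hP.gate (hG k) (gateLeft_ne_gateRight s k) hb (h₁ k) (h₂ k)

/-- On a ring of `4 * Q` sites, the property holds for two opposite quarters from which `m` sites
at either end have been removed. -/
def OnQuarters (P : Set (Fin N) → Set (Fin N) → ChainOp (Fin d) N → Prop) (Q m : ℕ)
    (X : ChainOp (Fin d) N) : Prop :=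
  P (arc N m (Q - m)) (arc N (2 * Q + m) (3 * Q - m)) X

variable {Q m : ℕ} {X : ChainOp (Fin d) N}

theorem IsLocalProperty.onQuarters_mono (hP : IsLocalProperty P) {m' : ℕ} (hm : m ≤ m')
    (h : OnQuarters P Q m X) : OnQuarters P Q m' X :=
  hP.mono (disjoint_arc (by omega)) (arc_subset_arc hm (by omega))
    (arc_subset_arc (by omega) (by omega)) h

theorem IsLocalProperty.onQuarters_layer_iff (hP : IsLocalProperty P) (hN : N = 4 * Q)
    (hQ : Even Q) (hm : m ≤ Q) {s : ℕ} (hms : m % 2 = s % 2)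
    {G : Fin (N / 2) → SuperOp (Fin d × Fin d)} (hG : ∀ k, IsReversible (G k))
    (X : ChainOp (Fin d) N) : OnQuarters P Q m (layer s G X) ↔ OnQuarters P Q m X := by
  have hN_even : Even N := hN ▸ hQ.mul_left 4
  obtain ⟨c, rfl⟩ := hQ
  exact hP.layer_iff (disjoint_arc (by omega))
    (gateLeft_mem_arc_iff hN_even hms (by omega) (by omega))
    (gateLeft_mem_arc_iff hN_even (by omega) (by omega) (by omega)) hG X

theorem IsLocalProperty.onQuarters_layer (hP : IsLocalProperty P) (hN : N = 4 * Q) (hQ : Even Q)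
    (hm : m + 1 ≤ Q) {s : ℕ} {G : Fin (N / 2) → SuperOp (Fin d × Fin d)}
    (hG : ∀ k, IsReversible (G k)) :
    (OnQuarters P Q m X → OnQuarters P Q (m + 1) (layer s G X)) ∧
      (OnQuarters P Q m (layer s G X) → OnQuarters P Q (m + 1) X) := by
  obtain ⟨m', hm', hm'', hs⟩ : ∃ m', m ≤ m' ∧ m' ≤ m + 1 ∧ m' % 2 = s % 2 := by
    rcases Nat.mod_two_eq_zero_or_one (m + s) with h | h
    · exact ⟨m, by omega⟩
    · exact ⟨m + 1, by omega⟩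
  have layer_iff := hP.onQuarters_layer_iff hN hQ (hm''.trans hm) hs hG X
  exact ⟨fun h => hP.onQuarters_mono hm'' (layer_iff.2 (hP.onQuarters_mono hm' h)),
    fun h => hP.onQuarters_mono hm'' (layer_iff.1 (hP.onQuarters_mono hm' h))⟩

theorem IsLocalProperty.onQuarters_brickwork (hP : IsLocalProperty P) (hN : N = 4 * Q)
    (hQ : Even Q) (hm : m + t ≤ Q) (hG : ∀ s, s < t → ∀ k, IsReversible (G s k))
    (h : OnQuarters P Q m X) : OnQuarters P Q (m + t) (brickwork G t X) := by
  induction t with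
  | zero => exact h
  | succ t ih =>
    exact (hP.onQuarters_layer hN hQ hm (hG t t.lt_succ_self)).1
      (ih (by omega) fun s hs => hG s (hs.trans t.lt_succ_self))

theorem IsLocalProperty.onQuarters_of_brickwork (hP : IsLocalProperty P) (hN : N = 4 * Q)
    (hQ : Even Q) (hm : m + t ≤ Q) (hG : ∀ s, s < t → ∀ k, IsReversible (G s k))
    (h : OnQuarters P Q m (brickwork G t X)) : OnQuarters P Q (m + t) X := by
  induction t generalizing m with
  | zero => exact h
  | succ t ih =>
    rw [← add_assoc, add_right_comm]
    exact ih (by omega) (fun s hs => hG s (hs.trans t.lt_succ_self))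
      ((hP.onQuarters_layer hN hQ (by omega) (hG t t.lt_succ_self)).2 h)

/-- The traces agree, and every local property of opposite quarters passes between the operators,
in both directions, at the cost of `t` sites at either end of the quarters. -/
structure IsLinked (t : ℕ) (X Y : ChainOp (Fin d) N) : Prop where
  trace_eq : Y.trace = X.trace
  forward : ∀ {P Q}, IsLocalProperty P → N = 4 * Q → Even Q → t ≤ Q → OnQuarters P Q 0 X →
    OnQuarters P Q t Y
  backward : ∀ {P Q}, IsLocalProperty P → N = 4 * Q → Even Q → t ≤ Q → OnQuarters P Q 0 Y →
    OnQuarters P Q t X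

theorem IsLinked.symm {X Y : ChainOp (Fin d) N} (h : IsLinked t X Y) : IsLinked t Y X :=
  ⟨h.trace_eq.symm, h.backward, h.forward⟩

theorem IsReversibleBrickwork.isLinked {E : End ℂ (ChainOp (Fin d) N)}
    (hE : IsReversibleBrickwork t E) (X : ChainOp (Fin d) N) : IsLinked t X (E X) := by
  obtain ⟨G, hG, rfl⟩ := hE
  refine ⟨trace_brickwork hG X, fun hP hNQ hQ ht h => ?_, fun hP hNQ hQ ht h => ?_⟩
  · rw [← zero_add t] at ht ⊢
    simpa only [zero_add] using hP.onQuarters_brickwork hNQ hQ ht hG h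
  · rw [← zero_add t] at ht ⊢
    exact hP.onQuarters_of_brickwork hNQ hQ ht hG h

end Circuits

section RingOperators

variable {n p q N d t χ v u : ℕ}

theorem TraceSplits.ringOp {α : Type} {A : LocalTensor (Fin p → α) χ}
    {B : LocalTensor (Fin p → α) v} {C : LocalTensor (Fin p → α) u} (hs : TraceSplits A B C)
    (h : n * p = N) : ringOp h A = ringOp h B + ringOp h C := by
  ext i j
  exact hs _

theorem cell_subset_compl_cell {x y : Fin n} (hxy : x ≠ y) : cell N p x ⊆ (cell N p y)ᶜ :=
  (disjoint_cell (Fin.val_ne_of_ne hxy)).subset_compl_right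

theorem traceOut_compl_cells (h : n * p = N) (x₁ x₂ : Fin n) :
    traceOut (cell N p x₁ ∪ cell N p x₂)ᶜ = onCells h
      (Function.update (Function.update (fun _ => traceCoeff (Fin p → Fin d)) x₁ 1) x₂ 1) := by
  classical
  ext i j
  have factor (x : Fin n) :
      Function.update (Function.update (fun _ => traceCoeff (Fin p → Fin d)) x₁ 1) x₂ 1 x
        (pairCells h (i, j) x) =
      if x ≠ x₁ → x ≠ x₂ → Set.EqOn i j (cell N p x) then 1 else 0 := by
    rw [Function.update_apply, Function.update_apply]
    split_ifs <;> simp_all [traceCoeff, pairCells_apply, cells_eq_iff]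
  have eqOn_iff : Set.EqOn i j (cell N p x₁ ∪ cell N p x₂)ᶜ ↔
      ∀ x : Fin n, x ≠ x₁ → x ≠ x₂ → Set.EqOn i j (cell N p x) := by
    refine ⟨fun hij x h₁ h₂ => hij.mono ?_, fun hij s hs => ?_⟩
    · rw [Set.compl_union]
      exact Set.subset_inter (cell_subset_compl_cell h₁) (cell_subset_compl_cell h₂)
    · obtain ⟨x, hx⟩ := exists_mem_cell h s
      exact hij x (fun h₁ => hs (Or.inl (h₁ ▸ hx))) (fun h₂ => hs (Or.inr (h₂ ▸ hx))) hx
  simp only [traceOut, onCells, of_apply, factor, eqOn_iff, Finset.prod_ite_zero,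
    Finset.mem_univ, true_imp_iff, Finset.prod_const_one]

theorem pairing_traceOut_ringOp (h : n * p = N) (A : LocalTensor (Fin p → Fin d) χ)
    {x₁ x₂ : Fin n} (hx : x₁ ≠ x₂) (a₁ a₂ : (Fin p → Fin d) × (Fin p → Fin d) → ℂ) :
    pairing (onCell h x₁ a₁ ⊙ (onCell h x₂ a₂ ⊙ traceOut (cell N p x₁ ∪ cell N p x₂)ᶜ))
        (ringOp h A) =
      (List.ofFn (Function.update (Function.update (fun _ => transferMatrix A) x₁ (contract A a₁))
        x₂ (contract A a₂))).prod.trace := by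
  rw [traceOut_compl_cells h, onCell_hadamard_onCells h (Function.update_self ..),
    Function.update_idem, onCell_hadamard_onCells h (by simp [hx]),
    Function.update_comm hx.symm, Function.update_idem, pairing_onCells_ringOp]
  congr 3
  funext x
  simp only [Function.update_apply]
  split_ifs
  · rfl
  · rfl
  · exact contract_traceCoeff A

theorem exists_trace_mul_ne_zero {l m n o R : Type*} [Fintype l] [Fintype m] [Fintype n]
    [Fintype o] [Semiring R] [NoZeroDivisors R] {M : Matrix l m R} {K : Matrix n o R}
    (hM : M ≠ 0) (hK : K ≠ 0) :
    ∃ (X : Matrix m n R) (Y : Matrix o l R), (M * X * K * Y).trace ≠ 0 := by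
  classical
  obtain ⟨a, b, hab⟩ : ∃ a b, M a b ≠ 0 := by
    by_contra! h
    exact hM (Matrix.ext h)
  obtain ⟨c, e, hce⟩ : ∃ c e, K c e ≠ 0 := by
    by_contra! h
    exact hK (Matrix.ext h)
  refine ⟨single b c 1, single e a 1, ?_⟩
  have entry : (M * (single b c 1 : Matrix m n R) * K : Matrix l o R) a e = M a b * K c e := by
    rw [mul_apply, Finset.sum_eq_single c (fun k _ hk => ?_) (by simp)]
    · simp
    · rw [mul_single_apply_of_ne _ _ _ _ _ hk, zero_mul]
  rw [trace_mul_single, MulOpposite.op_one, one_smul, entry]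
  exact mul_ne_zero hab hce

theorem onQuarters_zero (P : Set (Fin N) → Set (Fin N) → ChainOp (Fin d) N → Prop)
    (X : ChainOp (Fin d) N) :
    OnQuarters P p 0 X ↔ P (cell N p (0 : Fin 4)) (cell N p (2 : Fin 4)) X := by
  simp [OnQuarters, cell]

theorem onQuarters_independent_ringOp (h : 4 * p = N) {A : LocalTensor (Fin p → Fin d) χ}
    (hA : tensorSpan A = ⊤) : OnQuarters Independent p 0 (ringOp h A) := by
  rw [onQuarters_zero]
  intro f₁ f₂ hf₁ hf₂ hX
  rw [← hf₁.onCell_cellCoeff h, ← hf₂.onCell_cellCoeff h] at hX ⊢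
  set a₁ := cellCoeff h f₁
  set a₂ := cellCoeff h f₂
  by_cases h₁ : contract A a₁ = 0
  · exact Or.inl fun g hg => pairing_onCell_hadamard_ringOp_eq_zero h h₁ hg
  by_cases h₂ : contract A a₂ = 0
  · exact Or.inr fun g hg => pairing_onCell_hadamard_ringOp_eq_zero h h₂ hg
  obtain ⟨M, K, hMK⟩ := exists_trace_mul_ne_zero h₁ h₂
  obtain ⟨c₁, rfl⟩ := contract_surjective hA M
  obtain ⟨c₃, rfl⟩ := contract_surjective hA K
  refine absurd ?_ hMK
  have local_c : LocalOn (cell N p (0 : Fin 4) ∪ cell N p (2 : Fin 4))ᶜ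
      (onCells h ![1, c₁, 1, c₃]) := by
    refine localOn_onCells h fun x hx => ?_
    rw [Set.compl_union]
    refine Set.subset_inter (cell_subset_compl_cell ?_) (cell_subset_compl_cell ?_) <;>
      · rintro rfl
        exact hx rfl
  have functional : onCell h 0 a₁ ⊙ (onCell h 2 a₂ ⊙ onCells h ![1, c₁, 1, c₃]) =
      onCells h ![a₁, c₁, a₂, c₃] := by
    rw [onCell_hadamard_onCells h rfl, onCell_hadamard_onCells h rfl]
    congr 1
    funext x
    fin_cases x <;> rfl
  have := hX _ local_c
  rw [functional, pairing_onCells_ringOp] at this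
  rw [← this]
  simp [List.ofFn_succ, mul_assoc]

theorem pairing_onCells_eq_zero (h : n * p = N) {X : ChainOp (Fin d) N} {x : Fin n}
    {c : Fin n → (Fin p → Fin d) × (Fin p → Fin d) → ℂ}
    (hX : ∀ g, LocalOn (cell N p x)ᶜ g → pairing (onCell h x (c x) ⊙ g) X = 0) :
    pairing (onCells h c) X = 0 := by
  have := hX (onCells h (Function.update c x 1)) (localOn_onCells h fun y hy =>
    cell_subset_compl_cell fun hyx => hy (by rw [hyx, Function.update_self]))
  rwa [onCell_hadamard_onCells h (Function.update_self ..), Function.update_idem,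
    Function.update_eq_self] at this

theorem exists_contract_eq_zero_and_contract_eq {σ : Type} [Fintype σ] {B : LocalTensor σ v}
    {C : LocalTensor σ u} (hBC : ∀ M, ∃ a, contract B a = M ∧ contract C a = 0) (s : σ × σ) :
    ∃ a, contract B a = 0 ∧ contract C a = C s.1 s.2 := by
  classical
  have contract_single {k : ℕ} (A : LocalTensor σ k) :
      contract A (Pi.single s 1) = A s.1 s.2 := by
    rw [contract, Fintype.linearCombination_apply_single, one_smul]
  obtain ⟨a, haB, haC⟩ := hBC (B s.1 s.2)
  exact ⟨Pi.single s 1 - a, by rw [map_sub, contract_single, haB, sub_self],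
    by rw [map_sub, contract_single, haC, sub_zero]⟩

theorem ringOp_eq_zero_of_independent (h : n * p = N) {x y : Fin n} (hxy : x ≠ y) (hv : v ≠ 0)
    {B : LocalTensor (Fin p → Fin d) v} {C : LocalTensor (Fin p → Fin d) u}
    (hBC : ∀ M, ∃ a, contract B a = M ∧ contract C a = 0)
    (hind : Independent (cell N p x) (cell N p y) (ringOp h B + ringOp h C)) :
    ringOp h C = 0 := by
  ext i j
  obtain ⟨b, hbB, hbC⟩ := hBC 1
  choose a haB haC using fun z =>
    exists_contract_eq_zero_and_contract_eq hBC (pairCells h (i, j) z)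
  have local_cell {z z' : Fin n} (hz : z ≠ z') (c : (Fin p → Fin d) × (Fin p → Fin d) → ℂ) :
      LocalOn (cell N p z')ᶜ (onCell h z c) :=
    (localOn_onCell h z c).mono (cell_subset_compl_cell hz)
  have annihilated : ∀ g, LocalOn (cell N p x ∪ cell N p y)ᶜ g →
      pairing (onCell h x b ⊙ (onCell h y (a y) ⊙ g)) (ringOp h B + ringOp h C) = 0 := by
    intro g hg
    have hgB := (local_cell hxy b).hadamard
      (hg.mono (Set.compl_subset_compl.2 Set.subset_union_right))
    have hgC := (local_cell hxy.symm (a y)).hadamard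
      (hg.mono (Set.compl_subset_compl.2 Set.subset_union_left))
    rw [map_add, pairing_onCell_hadamard_ringOp_eq_zero h hbC hgC, add_zero, hadamard_left_swap,
      pairing_onCell_hadamard_ringOp_eq_zero h (haB y) hgB]
  rcases hind _ _ (localOn_onCell h x b) (localOn_onCell h y (a y)) annihilated with hb | ha
  · have := pairing_onCells_eq_zero h (c := fun _ => b) hb
    rw [map_add, pairing_onCells_ringOp, pairing_onCells_ringOp, hbB, hbC, List.ofFn_const,
      List.ofFn_const, List.prod_replicate, List.prod_replicate, one_pow,
      zero_pow (Fin.pos x).ne', trace_zero, add_zero, trace_one, Fintype.card_fin] at this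
    exact absurd (Nat.cast_eq_zero.1 this) hv
  · have := pairing_onCells_eq_zero h (c := a) ha
    simp only [map_add, pairing_onCells_ringOp, haB, haC, List.ofFn_const, List.prod_replicate,
      zero_pow (Fin.pos x).ne', trace_zero, zero_add] at this
    rw [ringOp, of_apply, wordProd_ofFn, this, Matrix.zero_apply]

theorem IsLocalProperty.of_onQuarters
    {P : Set (Fin N) → Set (Fin N) → ChainOp (Fin d) N → Prop} (hP : IsLocalProperty P)
    (ht : t ≤ q) {X : ChainOp (Fin d) N} (h : OnQuarters P (3 * q) t X) :
    P (cell N q (1 : Fin 12)) (cell N q (7 : Fin 12)) X :=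
  hP.mono (disjoint_arc (by omega)) (arc_subset_arc (by simpa using ht) (by simp; omega))
    (arc_subset_arc (by simp; omega) (by simp; omega)) h

end RingOperators

section TraceForm

variable {F m κ : Type*} [Field F] [Fintype m] [Fintype κ]

theorem exists_eq_mul_rank (S : Matrix m m F) :
    ∃ (W : Matrix m (Fin S.rank) F) (U : Matrix (Fin S.rank) m F), S = W * U := by
  classical
  obtain ⟨V, U, e, hV, hU, hVU⟩ := exists_rank_normal_form S
  rw [isUnit_iff_isUnit_det] at hV hU
  let J : Matrix (Fin S.rank ⊕ Fin (Fintype.card m - S.rank)) (Fin S.rank) F := fromRows 1 0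
  let J' : Matrix (Fin S.rank) (Fin S.rank ⊕ Fin (Fintype.card m - S.rank)) F := fromCols 1 0
  have normal_form : V * S * U = J.submatrix e id * J'.submatrix id e := by
    calc V * S * U = (fromBlocks 1 0 0 0).submatrix e e := hVU
      _ = (J * J').submatrix e e := by rw [fromRows_mul_fromCols]; simp
      _ = _ := rfl
  refine ⟨V⁻¹ * J.submatrix e id, J'.submatrix id e * U⁻¹, ?_⟩
  calc S = V⁻¹ * (V * S * U) * U⁻¹ := by
        rw [Matrix.mul_assoc V, nonsing_inv_mul_cancel_left _ _ hV,
          mul_nonsing_inv_cancel_right _ _ hU]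
    _ = _ := by rw [normal_form]; simp only [Matrix.mul_assoc]

theorem exists_mul_mul_eq_one_rank (S : Matrix m m F) :
    ∃ (W : Matrix (Fin S.rank) m F) (U : Matrix m (Fin S.rank) F), W * S * U = 1 := by
  classical
  obtain ⟨V, U, e, -, -, hVU⟩ := exists_rank_normal_form S
  refine ⟨V.submatrix (e.symm ∘ Sum.inl) id, U.submatrix id (e.symm ∘ Sum.inl), ?_⟩
  calc V.submatrix (e.symm ∘ Sum.inl) id * S * U.submatrix id (e.symm ∘ Sum.inl)
      = (V * S * U).submatrix (e.symm ∘ Sum.inl) (e.symm ∘ Sum.inl) := rfl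
    _ = 1 := by
      rw [hVU]
      ext i j
      simp

/-- The linear map `M ↦ W * M * U`. -/
def sandwich {k l n : Type*} [Fintype n] (W : Matrix k m F) (U : Matrix n l F) :
    Matrix m n F →ₗ[F] Matrix k l F :=
  mulRightLinearMap k F U ∘ₗ mulLeftLinearMap n F W

theorem exists_trace_mul_mul_mul_eq_sum (S : Matrix m m F) :
    ∃ α β : Fin S.rank × Fin S.rank → Dual F (Matrix m m F),
      ∀ M K, (M * S * K * S).trace = ∑ k, α k M * β k K := by
  obtain ⟨W, U, hS⟩ := exists_eq_mul_rank S
  refine ⟨fun k => entryLinearMap F F k.1 k.2 ∘ₗ sandwich U W,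
    fun k => entryLinearMap F F k.2 k.1 ∘ₗ sandwich U W, fun M K => ?_⟩
  calc (M * S * K * S).trace = (M * (W * U) * K * (W * U)).trace := by rw [← hS]
    _ = ((U * M * W) * (U * K * W)).trace := by
      rw [← Matrix.mul_assoc, trace_mul_comm]
      simp only [Matrix.mul_assoc]
    _ = _ := by
      rw [Fintype.sum_prod_type]
      rfl

theorem rank_mul_rank_le_card_of_trace_eq_sum {S : Matrix m m F}
    {α β : κ → Dual F (Matrix m m F)}
    (hS : ∀ M K, (M * S * K * S).trace = ∑ k, α k M * β k K) :
    S.rank * S.rank ≤ Fintype.card κ := by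
  obtain ⟨W, U, hWU⟩ := exists_mul_mul_eq_one_rank S
  have trace_eq (Z Y : Matrix (Fin S.rank) (Fin S.rank) F) :
      (Z * Y).trace = ∑ k, α k (sandwich U W Z) * β k (sandwich U W Y) := by
    calc (Z * Y).trace = (Z * (W * S * U) * Y * (W * S * U)).trace := by
          rw [hWU, Matrix.mul_one, Matrix.mul_one]
      _ = (U * Z * W * S * (U * Y * W) * S).trace := by
          rw [← Matrix.mul_assoc _ (W * S) U, trace_mul_comm _ U]
          simp only [Matrix.mul_assoc]
      _ = _ := hS _ _
  have injective : Function.Injective (LinearMap.pi fun k => β k ∘ₗ sandwich U W) := by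
    rw [← LinearMap.ker_eq_bot, LinearMap.ker_eq_bot']
    intro Y hY
    have hβ (k : κ) : β k (sandwich U W Y) = 0 := congrFun hY k
    refine ext_iff_trace_mul_left.2 fun Z => ?_
    simp only [trace_eq, hβ, mul_zero, Finset.sum_const_zero, trace_zero]
  simpa [finrank_matrix] using LinearMap.finrank_le_finrank_of_injective injective

end TraceForm

section SchmidtRank

variable {p q N d t χ v u : ℕ} {κ : Type} [Fintype κ]

theorem SchmidtRankLE.add {κ' : Type} [Fintype κ'] {b₁ b₂ : Set (Fin N)} {X Y : ChainOp (Fin d) N}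
    (hX : SchmidtRankLE κ b₁ b₂ X) (hY : SchmidtRankLE κ' b₁ b₂ Y) :
    SchmidtRankLE (κ ⊕ κ') b₁ b₂ (X + Y) := by
  obtain ⟨α, β, hαβ⟩ := hX
  obtain ⟨α', β', hαβ'⟩ := hY
  refine ⟨Sum.elim α α', Sum.elim β β', fun f₁ f₂ hf₁ hf₂ => ?_⟩
  rw [map_add, hαβ f₁ f₂ hf₁ hf₂, hαβ' f₁ f₂ hf₁ hf₂, Fintype.sum_sum_type]
  rfl

theorem pairing_traceOut_ringOp_four (h : 4 * p = N) (A : LocalTensor (Fin p → Fin d) χ)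
    (a₁ a₂ : (Fin p → Fin d) × (Fin p → Fin d) → ℂ) :
    pairing (onCell h 0 a₁ ⊙ (onCell h 2 a₂ ⊙
        traceOut (cell N p (0 : Fin 4) ∪ cell N p (2 : Fin 4))ᶜ)) (ringOp h A) =
      (contract A a₁ * transferMatrix A * contract A a₂ * transferMatrix A).trace := by
  rw [pairing_traceOut_ringOp h A (by decide)]
  simp [List.ofFn_succ, Function.update_apply, mul_assoc]

theorem prod_ofFn_update_update_twelve {M : Type*} [Monoid M] (c x y : M) :
    (List.ofFn (Function.update (Function.update (fun _ : Fin 12 => c) 1 x) 7 y)).prod =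
      c * (x * c ^ 5 * y * c ^ 4) := by
  change c * (x * (c * (c * (c * (c * (c * (y * (c * (c * (c * (c * 1))))))))))) = _
  simp only [pow_succ, pow_zero, one_mul, mul_one, mul_assoc]

theorem pairing_traceOut_ringOp_twelve (h : 12 * q = N) (A : LocalTensor (Fin q → Fin d) χ)
    (a₁ a₂ : (Fin q → Fin d) × (Fin q → Fin d) → ℂ) :
    pairing (onCell h 1 a₁ ⊙ (onCell h 7 a₂ ⊙
        traceOut (cell N q (1 : Fin 12) ∪ cell N q (7 : Fin 12))ᶜ)) (ringOp h A) =
      (contract A a₁ * transferMatrix A ^ 5 * contract A a₂ * transferMatrix A ^ 5).trace := by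
  rw [pairing_traceOut_ringOp h A (by decide), prod_ofFn_update_update_twelve, trace_mul_comm,
    mul_assoc _ (transferMatrix A ^ 4), ← pow_succ]

theorem onQuarters_schmidtRankLE_ringOp (h : 4 * p = N) (A : LocalTensor (Fin p → Fin d) χ) :
    OnQuarters (SchmidtRankLE (Fin (transferMatrix A).rank × Fin (transferMatrix A).rank)) p 0
      (ringOp h A) := by
  rw [onQuarters_zero]
  obtain ⟨α, β, hαβ⟩ := exists_trace_mul_mul_mul_eq_sum (transferMatrix A)
  refine ⟨fun k => α k ∘ₗ contract A ∘ₗ cellCoeff h, fun k => β k ∘ₗ contract A ∘ₗ cellCoeff h,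
    fun f₁ f₂ hf₁ hf₂ => ?_⟩
  conv_lhs => rw [← hf₁.onCell_cellCoeff h, ← hf₂.onCell_cellCoeff h]
  rw [pairing_traceOut_ringOp_four, hαβ]
  rfl

theorem rank_mul_rank_le_card_of_onQuarters_schmidtRankLE (h : 12 * q = N) (ht : t ≤ q)
    {A : LocalTensor (Fin q → Fin d) χ} (hA : tensorSpan A = ⊤)
    (hS : OnQuarters (SchmidtRankLE κ) (3 * q) t (ringOp h A)) :
    (transferMatrix A ^ 5).rank * (transferMatrix A ^ 5).rank ≤ Fintype.card κ := by
  obtain ⟨α, β, hαβ⟩ := (isLocalProperty_schmidtRankLE κ).of_onQuarters ht hS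
  obtain ⟨coeff, hcoeff⟩ := (contract A).exists_rightInverse_of_surjective
    (LinearMap.range_eq_top.2 (contract_surjective hA))
  have contract_coeff (M : Matrix (Fin χ) (Fin χ) ℂ) : contract A (coeff M) = M :=
    LinearMap.congr_fun hcoeff M
  refine rank_mul_rank_le_card_of_trace_eq_sum (α := fun k => α k ∘ₗ onCell h 1 ∘ₗ coeff)
    (β := fun k => β k ∘ₗ onCell h 7 ∘ₗ coeff) fun M K => ?_
  have := pairing_traceOut_ringOp_twelve h A (coeff M) (coeff K)
  rw [contract_coeff, contract_coeff] at this
  rw [← this, hαβ _ _ (localOn_onCell h 1 _) (localOn_onCell h 7 _)]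
  rfl

end SchmidtRank

section Blocking

variable {k p q d χ : ℕ}

theorem tensorSpan_blockTensor_eq_top {α : Type} {A : LocalTensor (Fin p → α) χ}
    (hA : tensorSpan A = ⊤) (hk : 1 ≤ k) : tensorSpan (blockTensor k A) = ⊤ := by
  rw [tensorSpan_blockTensor, hA]
  exact top_unique (le_self_pow le_top (Nat.one_le_iff_ne_zero.1 hk))

theorem IsStrongInjectiveTensor.blockTensor {A : LocalTensor (Fin p → Fin d) χ}
    (hA : IsStrongInjectiveTensor A) (hk : 1 ≤ k) : IsStrongInjectiveTensor (blockTensor k A) where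
  injective := (injective_virtualToPhysical_iff _).2 <|
    tensorSpan_blockTensor_eq_top ((injective_virtualToPhysical_iff A).1 hA.injective) hk
  transfer := by
    rw [transferMatrix_blockTensor]
    exact hA.transfer.pow (Nat.one_le_iff_ne_zero.1 hk)

theorem GeneratedBy.exists_generatedBy_of_dvd {ρ : ChainFamily d}
    {A : LocalTensor (Fin p → Fin d) χ} (hA : GeneratedBy ρ p A) (hq : 1 ≤ q) (hpq : p ∣ q) :
    ∃ A' : LocalTensor (Fin q → Fin d) χ, GeneratedBy ρ q A' ∧
      (IsStrongInjectiveTensor A → IsStrongInjectiveTensor A') := by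
  obtain ⟨k, rfl⟩ := exists_eq_mul_left_of_dvd hpq
  have hk : 1 ≤ k := Nat.pos_of_mul_pos_right hq
  exact ⟨_, hA.blockTensor hk, fun h => h.blockTensor hk⟩

end Blocking

section Components

variable {p χ v u : ℕ}

theorem exists_traceSplits_hasUniqueLargestEigenvalue {σ : Type} [Fintype σ] (A : LocalTensor σ χ)
    (hA : HasUniqueLargestEigenvalue (transferMatrix A)) :
    ∃ (v u : ℕ) (B : LocalTensor σ v) (C : LocalTensor σ u), TraceSplits A B C ∧
      HasUniqueLargestEigenvalue (transferMatrix B) ∧ ∃ l, ∀ k, l ≤ k → tensorSpan B ^ k = ⊤ := by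
  obtain ⟨r, hr, count_eq_one, norm_lt⟩ := (hasUniqueLargestEigenvalue_iff _).1 hA
  obtain ⟨v, u, B, C, hs, irreducible, hrB⟩ := exists_irreducible_traceSplits A
    (Multiset.count_pos.1 (count_eq_one ▸ one_pos))
  have eigenvalues_eq := hs.nonzeroEigenvalues_transferMatrix
  have hB : HasUniqueLargestEigenvalue (transferMatrix B) := by
    refine (hasUniqueLargestEigenvalue_iff _).2 ⟨r, hr, ?_, fun z hz => norm_lt z ?_⟩
    · rw [eigenvalues_eq, Multiset.count_add] at count_eq_one
      have := Multiset.count_pos.2 hrB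
      omega
    · exact eigenvalues_eq ▸ Multiset.mem_add.2 (Or.inl hz)
  exact ⟨v, u, B, C, hs, hB, exists_forall_tensorSpan_pow_eq_top irreducible hB⟩

theorem exists_contract_blockTensor_three {α : Type} [Fintype α]
    {B : LocalTensor (Fin p → α) v} {C : LocalTensor (Fin p → α) u} (hB : tensorSpan B = ⊤)
    (hTB : transferMatrix B ≠ 0) (hTC : transferMatrix C = 0) (M : Matrix (Fin v) (Fin v) ℂ) :
    ∃ a, contract (blockTensor 3 B) a = M ∧ contract (blockTensor 3 C) a = 0 := by
  classical
  let K := (LinearMap.ker (contract (blockTensor 3 C))).map (contract (blockTensor 3 B))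
  suffices hM : M ∈ K by
    obtain ⟨a, ha, rfl⟩ := hM
    exact ⟨a, rfl, ha⟩
  obtain ⟨i, j, hij⟩ : ∃ i j, transferMatrix B i j ≠ 0 := by
    by_contra! h
    exact hTB (Matrix.ext h)
  have mem_K (X Y : Matrix (Fin v) (Fin v) ℂ) : X * transferMatrix B * Y ∈ K := by
    obtain ⟨x, rfl⟩ := contract_surjective hB X
    obtain ⟨y, rfl⟩ := contract_surjective hB Y
    refine ⟨fun s => onCells rfl ![x, traceCoeff _, y] s.1 s.2, LinearMap.mem_ker.2 ?_, ?_⟩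
    · simp [contract_blockTensor, contract_traceCoeff, List.ofFn_succ, hTC]
    · simp [contract_blockTensor, contract_traceCoeff, List.ofFn_succ, mul_assoc]
  rw [matrix_eq_sum_single M]
  refine Submodule.sum_mem _ fun a _ => Submodule.sum_mem _ fun b _ => ?_
  have := mem_K (single a i (M a b * (transferMatrix B i j)⁻¹)) (single j b 1)
  rwa [single_mul_mul_single, mul_one, mul_assoc, inv_mul_cancel₀ hij, mul_one] at this

theorem pow_eq_zero_of_nonzeroEigenvalues_eq_zero {K ι : Type*} [Field K] [DecidableEq K]
    [IsAlgClosed K] [Fintype ι] [DecidableEq ι] {T : Matrix ι ι K} (hT : nonzeroEigenvalues T = 0)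
    {m : ℕ} (hm : Fintype.card ι ≤ m) : T ^ m = 0 := by
  have rank_eq_zero : (T ^ m).rank = 0 := by
    rw [← card_nonzeroEigenvalues T hm, hT, Multiset.card_zero]
  rw [rank, Submodule.finrank_eq_zero, LinearMap.range_eq_bot] at rank_eq_zero
  exact toLin'.map_eq_zero_iff.1 rank_eq_zero

theorem HasUniqueLargestEigenvalue.card_nonzeroEigenvalues_pos {T : Matrix (Fin χ) (Fin χ) ℂ}
    (hT : HasUniqueLargestEigenvalue T) : 0 < (nonzeroEigenvalues T).card := by
  obtain ⟨r, -, hr, -⟩ := (hasUniqueLargestEigenvalue_iff T).1 hT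
  exact Multiset.card_pos_iff_exists_mem.2 ⟨r, Multiset.count_pos.1 (hr ▸ one_pos)⟩

theorem HasUniqueLargestEigenvalue.ne_zero {T : Matrix (Fin χ) (Fin χ) ℂ}
    (hT : HasUniqueLargestEigenvalue T) : T ≠ 0 := by
  rintro rfl
  have := card_nonzeroEigenvalues (0 : Matrix (Fin χ) (Fin χ) ℂ) (m := χ + 1) (by simp)
  rw [zero_pow χ.succ_ne_zero, rank_zero] at this
  exact hT.card_nonzeroEigenvalues_pos.ne' this

end Components

section LinkedFamilies

variable {q N d t χ χ' v u : ℕ} {ρ σ : ChainFamily d} {A : LocalTensor (Fin q → Fin d) χ}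
  {D : LocalTensor (Fin q → Fin d) χ'} {B : LocalTensor (Fin q → Fin d) v}
  {C : LocalTensor (Fin q → Fin d) u}

theorem nonzeroEigenvalues_transferMatrix_eq_of_isLinked (hq : 1 ≤ q) (hqe : Even q)
    (hρ : GeneratedBy ρ q A) (hσ : GeneratedBy σ q D)
    (hl : ∀ N, 1 ≤ N → Even N → IsLinked t (ρ N) (σ N)) :
    nonzeroEigenvalues (transferMatrix A) = nonzeroEigenvalues (transferMatrix D) :=
  nonzeroEigenvalues_eq_of_trace_pow fun k hk => by
    rw [← trace_ringOp rfl, ← trace_ringOp rfl, ← generatedBy_iff.1 hρ k _ rfl hk,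
      ← generatedBy_iff.1 hσ k _ rfl hk]
    exact (hl (k * q) (Nat.mul_pos hk hq) (hqe.mul_left k)).trace_eq.symm

/-- The operator Schmidt rank of `ρ` between two separated regions is the square of the number of
nonzero eigenvalues of its transfer matrix, that of `σ` is at most the sum of the two squares for
`B` and `C`. -/
theorem nonzeroEigenvalues_eq_zero_of_isLinked (hq : 1 ≤ q) (hqe : Even q)
    (hρ : GeneratedBy ρ q A) (hA : tensorSpan A = ⊤) (hσ : GeneratedBy σ q D)
    (hs : TraceSplits D B C) (hB : 0 < (nonzeroEigenvalues (transferMatrix B)).card)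
    (hl : ∀ N, 1 ≤ N → Even N → IsLinked t (ρ N) (σ N)) :
    nonzeroEigenvalues (transferMatrix C) = 0 := by
  have eigenvalues_eq := (nonzeroEigenvalues_transferMatrix_eq_of_isLinked hq hqe hρ hσ hl).trans
    hs.nonzeroEigenvalues_transferMatrix
  obtain ⟨m, hm⟩ : ∃ m, m = χ + v + u + t + 1 := ⟨_, rfl⟩
  have hmq : m ≤ m * q := Nat.le_mul_of_pos_right m hq
  obtain ⟨N, h12⟩ : ∃ N, 12 * (m * q) = N := ⟨_, rfl⟩
  have h4 : 4 * (3 * (m * q)) = N := by omega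
  have hρN : ρ N = ringOp h12 (blockTensor m A) :=
    generatedBy_iff.1 (hρ.blockTensor (by omega)) _ _ _ (by omega)
  have hσN : σ N = ringOp h4 (blockTensor 3 (blockTensor m B)) +
      ringOp h4 (blockTensor 3 (blockTensor m C)) := by
    rw [← ((hs.blockTensor m).blockTensor 3).ringOp h4]
    exact generatedBy_iff.1 ((hσ.blockTensor (by omega)).blockTensor (by omega)) _ _ _ (by omega)
  have schmidt_σ :=
    (onQuarters_schmidtRankLE_ringOp h4 (blockTensor 3 (blockTensor m B))).add
      (onQuarters_schmidtRankLE_ringOp h4 (blockTensor 3 (blockTensor m C)))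
  rw [← hσN] at schmidt_σ
  have schmidt_ρ := (hl N (by omega) (h12 ▸ (hqe.mul_left m).mul_left 12)).backward
    (isLocalProperty_schmidtRankLE _) h4.symm ((hqe.mul_left m).mul_left 3) (by omega) schmidt_σ
  rw [hρN] at schmidt_ρ
  have rank_sq_le := rank_mul_rank_le_card_of_onQuarters_schmidtRankLE h12 (by omega)
    (tensorSpan_blockTensor_eq_top hA (by omega)) schmidt_ρ
  simp only [Fintype.card_sum, Fintype.card_prod, Fintype.card_fin, transferMatrix_blockTensor,
    ← pow_mul] at rank_sq_le
  rw [← card_nonzeroEigenvalues _ (by simp; omega), ← card_nonzeroEigenvalues _ (by simp; omega),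
    ← card_nonzeroEigenvalues _ (by simp; omega), eigenvalues_eq, Multiset.card_add] at rank_sq_le
  exact Multiset.card_eq_zero.1 (by nlinarith)

theorem ringOp_eq_zero_of_isLinked (hq : 1 ≤ q) (hqe : Even q) (hρ : GeneratedBy ρ q A)
    (hA : tensorSpan A = ⊤) (hσ : GeneratedBy σ q D) (hs : TraceSplits D B C)
    (hl : ∀ N, 1 ≤ N → Even N → IsLinked t (ρ N) (σ N)) {m : ℕ} (hm : 1 ≤ m) (htm : t ≤ m)
    (hB : tensorSpan B ^ m = ⊤) (hTB : transferMatrix B ^ m ≠ 0) (hTC : transferMatrix C ^ m = 0)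
    {k : ℕ} (hk : k = 36 * m) (h : k * q = N) : ringOp h C = 0 := by
  have hmq : m ≤ m * q := Nat.le_mul_of_pos_right m hq
  have h36 : 36 * (m * q) = N := by rw [← h, hk, mul_assoc]
  have h12 : 12 * (3 * (m * q)) = N := by omega
  have h4 : 4 * (3 * (3 * (m * q))) = N := by omega
  have hρN : ρ N = ringOp h4 (blockTensor 3 (blockTensor 3 (blockTensor m A))) :=
    generatedBy_iff.1 (((hρ.blockTensor (by omega)).blockTensor (by omega)).blockTensor (by omega))
      _ _ _ (by omega)
  have hσN : σ N = ringOp h12 (blockTensor 3 (blockTensor m B)) +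
      ringOp h12 (blockTensor 3 (blockTensor m C)) := by
    rw [← ((hs.blockTensor m).blockTensor 3).ringOp h12]
    exact generatedBy_iff.1 ((hσ.blockTensor (by omega)).blockTensor (by omega)) _ _ _ (by omega)
  have hAm : tensorSpan (blockTensor 3 (blockTensor 3 (blockTensor m A))) = ⊤ := by
    iterate 3 refine tensorSpan_blockTensor_eq_top ?_ (by omega)
    exact hA
  have independent_ρ := onQuarters_independent_ringOp h4 hAm
  rw [← hρN] at independent_ρ
  have independent_σ := (hl N (by omega) (h ▸ hqe.mul_left k)).forward isLocalProperty_independent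
    h4.symm (((hqe.mul_left m).mul_left 3).mul_left 3) (by omega) independent_ρ
  rw [hσN] at independent_σ
  have separates := exists_contract_blockTensor_three (B := blockTensor m B) (C := blockTensor m C)
    (by rw [tensorSpan_blockTensor, hB]) (by rwa [transferMatrix_blockTensor])
    (by rwa [transferMatrix_blockTensor])
  have hv : v ≠ 0 := by
    rintro rfl
    exact hTB (Subsingleton.elim _ _)
  have := ringOp_eq_zero_of_independent h12 (x := 1) (y := 7) (by decide) hv separates
    (isLocalProperty_independent.of_onQuarters (by omega) independent_σ)
  subst hk
  rwa [ringOp_blockTensor h12 h36, ringOp_blockTensor h36 h] at this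

theorem isStrongInjective_of_generatedBy_of_isLinked (hq : 1 ≤ q) (hqe : Even q)
    (hρ : GeneratedBy ρ q A) (hA : IsStrongInjectiveTensor A)
    (hσ : GeneratedBy σ q D) (hl : ∀ N, 1 ≤ N → Even N → IsLinked t (ρ N) (σ N)) :
    IsStrongInjective σ := by
  have hAs := (injective_virtualToPhysical_iff A).1 hA.injective
  have hD := hA.transfer.congr (nonzeroEigenvalues_transferMatrix_eq_of_isLinked hq hqe hρ hσ hl)
  obtain ⟨v, u, B, C, hs, hB, l, hl_top⟩ := exists_traceSplits_hasUniqueLargestEigenvalue D hD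
  have hC := nonzeroEigenvalues_eq_zero_of_isLinked hq hqe hρ hAs hσ hs
    hB.card_nonzeroEigenvalues_pos hl
  obtain ⟨m, hm⟩ : ∃ m, m = l + u + t + 1 := ⟨_, rfl⟩
  have ringOp_C {n N : ℕ} (hn : 1 ≤ n) (h : n * (36 * m) * q = N) : ringOp h C = 0 := by
    have hmn : m ≤ n * m := Nat.le_mul_of_pos_left m hn
    exact ringOp_eq_zero_of_isLinked hq hqe hρ hAs hσ hs hl (m := n * m) (by omega) (by omega)
      (hl_top _ (by omega)) (hB.pow (by omega)).ne_zero
      (pow_eq_zero_of_nonzeroEigenvalues_eq_zero hC (by simp; omega)) (by ring) h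
  refine ⟨36 * m * q, Nat.mul_pos (by omega) hq, v, blockTensor (36 * m) B, ⟨?_, ?_⟩, ?_⟩
  · rw [injective_virtualToPhysical_iff, tensorSpan_blockTensor, hl_top _ (by omega)]
  · rw [transferMatrix_blockTensor]
    exact hB.pow (by omega)
  · refine generatedBy_iff.2 fun n N h hn => ?_
    have h' : n * (36 * m) * q = N := by rw [mul_assoc, h]
    rw [generatedBy_iff.1 hσ _ N h' (Nat.mul_pos hn (by omega)), hs.ringOp h', ringOp_C hn h',
      add_zero, ringOp_blockTensor h h']

/-- A matrix product operator family: generated by some tensor for some unit cell, with no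
positivity required. -/
def IsMPO (ρ : ChainFamily d) : Prop :=
  ∃ p : ℕ, 1 ≤ p ∧ ∃ (χ : ℕ) (A : LocalTensor (Fin p → Fin d) χ), GeneratedBy ρ p A

theorem IsStrongInjective.of_isLinked (hρ : IsStrongInjective ρ) (hσ : IsMPO σ)
    (hl : ∀ N, 1 ≤ N → Even N → IsLinked t (ρ N) (σ N)) : IsStrongInjective σ := by
  obtain ⟨p, hp, χ, A, hA, hρA⟩ := hρ
  obtain ⟨p', hp', χ', D, hσD⟩ := hσ
  have hq : 1 ≤ 2 * (p * p') := Nat.mul_pos two_pos (Nat.mul_pos hp hp')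
  obtain ⟨A', hρA', hA'⟩ := hρA.exists_generatedBy_of_dvd hq
    ((Nat.dvd_mul_right p p').mul_left 2)
  obtain ⟨D', hσD', -⟩ := hσD.exists_generatedBy_of_dvd hq ((Nat.dvd_mul_left p' p).mul_left 2)
  exact isStrongInjective_of_generatedBy_of_isLinked hq (even_two_mul _) hρA' (hA' hA) hσD' hl

theorem IsMPDO.isMPO (hρ : IsMPDO ρ) : IsMPO ρ := by
  obtain ⟨p, hp, hA, -⟩ := hρ
  exact ⟨p, hp, hA⟩

end LinkedFamilies

end StrongInjectiveMPDO

open StrongInjectiveMPDO in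
theorem mainTheorem4_general {d t : ℕ} {ρ ρ' : ChainFamily d} (hρ : IsMPO ρ) (hρ' : IsMPO ρ')
    {E : (N : ℕ) → Module.End ℂ (ChainOp (Fin d) N)}
    (hE : ∀ N : ℕ, 1 ≤ N → Even N → IsReversibleBrickwork t (E N))
    (h : ∀ N : ℕ, 1 ≤ N → Even N → ρ' N = E N (ρ N)) :
    IsStrongInjective ρ' ↔ IsStrongInjective ρ := by
  have linked (N : ℕ) (hN : 1 ≤ N) (hNe : Even N) : IsLinked t (ρ N) (ρ' N) :=
    h N hN hNe ▸ (hE N hN hNe).isLinked (ρ N)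
  exact ⟨fun hs => hs.of_isLinked hρ fun N hN hNe => (linked N hN hNe).symm,
    fun hs => hs.of_isLinked hρ' linked⟩

theorem mainTheorem4 (d t : ℕ)
    (ρ ρ' : StrongInjectiveMPDO.ChainFamily d)
    (hρ : StrongInjectiveMPDO.IsMPDO ρ) (hρ' : StrongInjectiveMPDO.IsMPDO ρ')
    (𝒩 : (N : ℕ) → Module.End ℂ (StrongInjectiveMPDO.ChainOp (Fin d) N))
    (h𝒩 : ∀ N : ℕ, 1 ≤ N → Even N → StrongInjectiveMPDO.IsNondegenerateBrickwork t (𝒩 N))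
    (h : ∀ N : ℕ, 1 ≤ N → Even N → ρ' N = 𝒩 N (ρ N)) :
    StrongInjectiveMPDO.IsStrongInjective ρ' ↔ StrongInjectiveMPDO.IsStrongInjective ρ :=
  mainTheorem4_general hρ.isMPO hρ'.isMPO
    (fun N hN hNe => (h𝒩 N hN hNe).isReversibleBrickwork) h
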